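/- **Language.** $\mathcal L_{FS}$ is the first-order language with equality, individual constants $\mathsf k,\mathsf s$ (combinators), $\mathsf p,\mathsf p_0,\mathsf p_1$ (pairing, projections), $\mathsf 0,\mathsf s_{\mathsf N},\mathsf p_{\mathsf N},\mathsf d_{\mathsf N}$ (zero, successor, predecessor, definition by numerical cases), $\dot=,\dot\neg,\dot\wedge,\dot\to,\dot\forall,\dot{\mathsf N},\mathsf l$, a binary function symbol for application (written $ab$, associated to the left), and unary predicates $\mathrm N,\mathrm T,\mathrm U$. Write $(a,b):=\mathsf pab$, $a\mathbin{\dot=}b:=\dot=(a,b)$, and similarly $a\mathbin{\dot\wedge}b$, $a\mathbin{\dot\to}b$; $\mathrm P(x):\equiv \mathrm T(x)\vee\mathrm T(\dot\neg x)$; $\mathrm C(f):\equiv\forall x\,\mathrm P(fx)$; $f\sqsubset g:\equiv [\forall x(\mathrm T(fx)\to\mathrm T(g(fx)))]\wedge[\forall x(\mathrm T(\dot\neg(fx))\to\mathrm T(g(\dot\neg(fx))))]$. **Theories** (axioms are understood as universally closed). * $\mathsf{TON}$: $\mathsf kab=a$; $\mathsf sabc=ac(bc)$; $\mathsf p_0(a,b)=a\wedge\mathsf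 p_1(a,b)=b$; $\mathrm N(\mathsf 0)\wedge\forall x(\mathrm N(x)\to\mathrm N(\mathsf s_{\mathsf N}x))$; $\mathrm N(x)\to\mathsf s_{\mathsf N}x\ne\mathsf 0\wedge\mathsf p_{\mathsf N}(\mathsf s_{\mathsf N}x)=x$; $\mathrm N(x)\wedge x\neq\mathsf 0\to\mathrm N(\mathsf p_{\mathsf N}x)\wedge\mathsf s_{\mathsf N}(\mathsf p_{\mathsf N}x)=x$; for $\mathrm N(a),\mathrm N(b)$: $\mathsf d_{\mathsf N}uvab=u$ if $a=b$, and $\mathsf d_{\mathsf N}uvab=v$ if $a\ne b$; and induction along $\mathrm N$ for every $\mathcal L_{FS}$-formula (parameters allowed). * $\mathsf{KF}$: $\mathsf{TON}$ and $\mathrm T(x\dot=y)\leftrightarrow x=y$; $\mathrm T(\dot\neg(x\dot=y))\leftrightarrow x\neq y$; $\mathrm T(\dot{\mathsf N}x)\leftrightarrow\mathrm N(x)$; $\mathrm T(\dot\neg(\dot{\mathsf N}x))\leftrightarrow\neg\mathrm N(x)$; $\mathrm T(\dot\neg(\dot\neg x))\leftrightarrow\mathrm T(x)$; $\mathrm T(x\dot\wedge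 y)\leftrightarrow\mathrm T(x)\wedge\mathrm T(y)$; $\mathrm T(\dot\neg(x\dot\wedge y))\leftrightarrow\mathrm T(\dot\neg x)\vee\mathrm T(\dot\neg y)$; $\mathrm T(x\dot\to y)\leftrightarrow\mathrm T(\dot\neg x)\vee\mathrm T(y)$; $\mathrm T(\dot\neg(x\dot\to y))\leftrightarrow\mathrm T(x)\wedge\mathrm T(\dot\neg y)$; $\mathrm T(\dot\forall f)\leftrightarrow\forall x\,\mathrm T(fx)$; $\mathrm T(\dot\neg(\dot\forall f))\leftrightarrow\exists x\,\mathrm T(\dot\neg(fx))$; $\neg[\mathrm T(x)\wedge\mathrm T(\dot\neg x)]$. * $\mathsf{KFU}$: $\mathsf{TON}$ and: for each truth axiom of $\mathsf{KF}$, the axiom "$\mathrm U(u)\to\dots$" in which every $\mathrm T(t)$ is replaced by $\mathrm T(ut)$; $\mathrm U(u)\to\mathrm C(u)$; $\mathrm U(u)\to\forall x(\mathrm T(ux)\to\mathrm T(x))$; $\mathrm C(f)\to\mathrm U(\mathsf lf)\wedge f\sqsubset\mathsf lf$. * $(\mathsf{UG})$: for $c,d\in\{\dot=,\dot\neg,\dot\wedge,\dot\to,\dot\forall,\dot{\mathsf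 N},\mathsf l\}$: $c\ne d$ and $ca\neq db$ if $c,d$ are distinct symbols; $ca\ne d$; $ca=cb\to a=b$; $\mathsf lab\ne c$; $\mathsf lab\neq cd'$ (any $d'$); $\mathsf lab=\mathsf la'b'\to a=a'\wedge b=b'$. * $(\mathsf{PI})$: for every $\mathcal L_{FS}$-formula $B(x)$ (parameters allowed), $[\forall x(\mathscr A(B(\bullet),x)\to B(x))]\to\forall x(\mathrm P(x)\to B(x))$, where $\mathscr A(B(\bullet),x)$ is the disjunction of 1. $\exists y,z.\ x=(y\mathbin{\dot=}z)$; 2. $\exists y.\ x=\dot{\mathsf N}y$; 3. $\exists y.\ x=\dot\neg y\wedge B(y)$; 4. $\exists y,z.\ x=y\mathbin{\dot\wedge}z\wedge\{[B(y)\wedge B(z)]\vee[B(y)\wedge\mathrm T(\dot\neg y)]\vee[B(z)\wedge\mathrm T(\dot\neg z)]\}$; 5. $\exists y,z.\ x=y\mathbin{\dot\to}z\wedge\{[B(y)\wedge B(z)]\vee[B(y)\wedge\mathrm T(\dot\neg y)]\vee[B(z)\wedge\mathrm T(z)]\}$; 6. $\exists g.\ x=\dot\forall g\wedge\{[\forall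 y\,B(gy)]\vee\exists y[B(gy)\wedge\mathrm T(\dot\neg(gy))]\}$; 7. $\exists f,y.\ x=\mathsf lfy\wedge\forall z\,B(fz)$. * $\mathsf{KFUPI}:=\mathsf{KFU}+(\mathsf{UG})+(\mathsf{PI})$. **The model $\mathcal M_{\mathsf{KF}}$.** The domain is the set of closed $\mathcal L_{FS}$-terms, where equality is convertibility with respect to the reduction generated, in all contexts, by $\mathsf kab\to a$, $\mathsf sabc\to ac(bc)$, $\mathsf p_0(\mathsf pab)\to a$, $\mathsf p_1(\mathsf pab)\to b$, $\mathsf p_{\mathsf N}(\mathsf s_{\mathsf N}\bar n)\to\bar n$, $\mathsf d_{\mathsf N}uv\bar n\bar n\to u$, $\mathsf d_{\mathsf N}uv\bar m\bar n\to v$ for $m\neq n$ (with $\bar n=\mathsf s_{\mathsf N}^n\mathsf 0$ the numerals). Application is juxtaposition, constants denote themselves, and $\mathrm N$ holds of the terms that reduce to a numeral (up to convertibility). For sets $X,Y$ of elements, an element $a$ and an ordinal $\alpha$, let $\Phi(X,Y,a,\alpha)$ hold iff one of the following holds: 1. $a\in Y$; 2. $\alpha=0$ and, for some $b,c$: $a=(b\dot=c)$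 and $b=c$; or $a=\dot\neg(b\dot=c)$ and $b\ne c$; or $a=\dot{\mathsf N}b$ and $\mathrm N(b)$; or $a=\dot\neg(\dot{\mathsf N}b)$ and $\neg\mathrm N(b)$; 3. $a\notin Y$ and, for some $b,c,f$: $a=\dot\neg(\dot\neg b)$ and $b\in X$; or $a=b\dot\wedge c$ and $b,c\in X$; or $a=\dot\neg(b\dot\wedge c)$ and ($\dot\neg b\in X$ or $\dot\neg c\in X$); or $a=b\dot\to c$ and ($\dot\neg b\in X$ or $c\in X$); or $a=\dot\neg(b\dot\to c)$ and $b,\dot\neg c\in X$; or $a=\dot\forall f$ and $fx\in X$ for all $x$; or $a=\dot\neg(\dot\forall f)$ and $\dot\neg(fx)\in X$ for some $x$; 4. $\alpha$ is a successor, $a\notin Y$, $\dot\neg a\notin Y$ and, for some $b,c$ such that $bx\in Y$ or $\dot\neg(bx)\in Y$ for every $x$: $a=\mathsf lbc$ and $c\in Y$; or $a=\dot\neg(\mathsf lbc)$ and $c\notin Y$. Let $Z_0$ be the least fixed point of $X\mapsto\{a:\Phi(X,\emptyset,a,0)\}$, let $Z_{\alpha+1}$ be that of $X\mapsto\{a:\Phi(X,Z_\alpha,a,\alpha+1)\}$,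 and for a limit $\alpha$ let $Z_\alpha$ be that of $X\mapsto\{a:\Phi(X,\bigcup_{\beta<\alpha}Z_\beta,a,\alpha)\}$. Let $\iota$ be the least ordinal with $Z_\iota=Z_{\iota+1}$ (it exists). Interpret $\mathrm T$ by $Z_\iota$, and let $\mathrm U(u)$ hold iff $u=\mathsf lf$ for some $f$ such that $fx\in Z_\iota$ or $\dot\neg(fx)\in Z_\iota$ for every $x$. **Proposition.** $\mathcal M_{\mathsf{KF}}\models\mathsf{KFUPI}$, and $\mathcal M_{\mathsf{KF}}\models\mathsf{KF}$. -/

import Mathlib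

open FirstOrder FirstOrder.Language

namespace FregeStructure

/-! ## The language -/

/-- The individual constants: combinators, pairing and projections, zero, successor, predecessor,
definition by numerical cases, the seven constants of Frege structures `≐, ¬̇, ∧̇, →̇, ∀̇, Ṅ` and
the universe generator `l`. -/
inductive Const : Type
  | k | s | p | p0 | p1 | zero | sN | pN | dN
  | eqC | negC | andC | impC | allC | natC | l
  deriving DecidableEq

/-- Function symbols: the constants, and binary application. -/
inductive FSFunc : ℕ → Type
  | const (c : Const) : FSFunc 0
  | app : FSFunc 2

/-- Relation symbols: the unary predicates `N`, `T`, `U`. -/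
inductive FSRel : ℕ → Type
  | N : FSRel 1
  | T : FSRel 1
  | U : FSRel 1

/-- The first-order language of Frege structures. -/
def LFS : FirstOrder.Language.{0, 0} := ⟨FSFunc, FSRel⟩

/-! ## Applicative notation, used both for terms and for elements of the model -/

class AppStr (M : Type) where
  app : M → M → M
  const : Const → M

infixl:90 " ⬝ " => AppStr.app

section AppNotation

variable {M : Type} [AppStr M]

/-- A constant symbol as a term, or its value. -/
def cst (c : Const) : M := AppStr.const c

/-- `(a, b) := p a b`. -/
def pair (a b : M) : M := cst .p ⬝ a ⬝ b

/-- `a ≐ b := ≐ (a, b)`. -/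
def dEq (a b : M) : M := cst .eqC ⬝ pair a b

/-- `¬̇ a`. -/
def dNeg (a : M) : M := cst .negC ⬝ a

/-- `a ∧̇ b := ∧̇ (a, b)`. -/
def dAnd (a b : M) : M := cst .andC ⬝ pair a b

/-- `a →̇ b := →̇ (a, b)`. -/
def dImp (a b : M) : M := cst .impC ⬝ pair a b

/-- `∀̇ f`. -/
def dAll (f : M) : M := cst .allC ⬝ f

/-- `Ṅ a`. -/
def dNat (a : M) : M := cst .natC ⬝ a

/-- `l f`. -/
def lim (f : M) : M := cst .l ⬝ f

/-- The numerals `s_N (… (s_N 0))`. -/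
def num : ℕ → M
  | 0 => cst .zero
  | n + 1 => cst .sN ⬝ num n

end AppNotation

instance {α : Type} : AppStr (LFS.Term α) where
  app t u := Functions.apply₂ (L := LFS) FSFunc.app t u
  const c := Constants.term (L := LFS) (FSFunc.const c)

/-! ## The closed total term model -/

/-- Closed terms. -/
abbrev ClosedTerm : Type := LFS.Term Empty

/-- One-step reduction of closed terms. The constants of Frege structures are inert. -/
inductive Red : ClosedTerm → ClosedTerm → Prop
  | k (a b : ClosedTerm) : Red (cst .k ⬝ a ⬝ b) a
  | s (a b c : ClosedTerm) : Red (cst .s ⬝ a ⬝ b ⬝ c) (a ⬝ c ⬝ (b ⬝ c))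
  | p0 (a b : ClosedTerm) : Red (cst .p0 ⬝ pair a b) a
  | p1 (a b : ClosedTerm) : Red (cst .p1 ⬝ pair a b) b
  | pN (n : ℕ) : Red (cst .pN ⬝ num (n + 1)) (num n)
  | dN_eq (u v : ClosedTerm) (n : ℕ) : Red (cst .dN ⬝ u ⬝ v ⬝ num n ⬝ num n) u
  | dN_ne (u v : ClosedTerm) (m n : ℕ) (h : m ≠ n) : Red (cst .dN ⬝ u ⬝ v ⬝ num m ⬝ num n) v
  | appL {a a' : ClosedTerm} (b : ClosedTerm) : Red a a' → Red (a ⬝ b) (a' ⬝ b)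
  | appR (a : ClosedTerm) {b b' : ClosedTerm} : Red b b' → Red (a ⬝ b) (a ⬝ b')

/-- Reduction in finitely many steps. -/
def Reduces : ClosedTerm → ClosedTerm → Prop := Relation.ReflTransGen Red

/-- Convertibility: the equivalence relation generated by reduction. -/
def convSetoid : Setoid ClosedTerm := Relation.EqvGen.setoid Red

/-- The domain: closed terms, where convertible terms are identified, so that the equality symbol
is interpreted by equality. -/
def MKF : Type := Quotient convSetoid

theorem conv_app {a a' b b' : ClosedTerm} (ha : convSetoid.r a a') (hb : convSetoid.r b b') :
    convSetoid.r (a ⬝ b) (a' ⬝ b') := by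
  have h1 : ∀ {a a' : ClosedTerm} (b : ClosedTerm), Relation.EqvGen Red a a' →
      Relation.EqvGen Red (a ⬝ b) (a' ⬝ b) := by
    intro a a' b h
    induction h with
    | rel _ _ h => exact .rel _ _ (.appL b h)
    | refl _ => exact .refl _
    | symm _ _ _ ih => exact .symm _ _ ih
    | trans _ _ _ _ _ ih ih' => exact .trans _ _ _ ih ih'
  have h2 : ∀ (a : ClosedTerm) {b b' : ClosedTerm}, Relation.EqvGen Red b b' →
      Relation.EqvGen Red (a ⬝ b) (a ⬝ b') := by
    intro a b b' h
    induction h with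
    | rel _ _ h => exact .rel _ _ (.appR a h)
    | refl _ => exact .refl _
    | symm _ _ _ ih => exact .symm _ _ ih
    | trans _ _ _ _ _ ih ih' => exact .trans _ _ _ ih ih'
  exact Relation.EqvGen.trans _ _ _ (h1 b ha) (h2 a' hb)

/-- The class of a closed term. -/
def cls (t : ClosedTerm) : MKF := Quotient.mk convSetoid t

/-- Application is juxtaposition; constants are interpreted by themselves. -/
instance : AppStr MKF where
  app := Quotient.map₂ (fun t u : ClosedTerm => t ⬝ u) fun _ _ ha _ _ hb => conv_app ha hb
  const c := cls (cst c)

/-- `N` holds of a term that reduces to a numeral. -/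
def IsN (a : MKF) : Prop := ∃ t : ClosedTerm, cls t = a ∧ ∃ n : ℕ, Reduces t (num n)

/-! ## The stages of truth -/

/-- `α` is a successor ordinal. -/
def IsSuc (α : Ordinal.{0}) : Prop := ∃ β : Ordinal.{0}, α = β + 1

/-- `b` is a class relative to `Y`. -/
def ClassIn (Y : Set MKF) (b : MKF) : Prop := ∀ x, b ⬝ x ∈ Y ∨ dNeg (b ⬝ x) ∈ Y

/-- The operator `Φ(X, Y, a, α)`. -/
def Phi (X Y : Set MKF) (a : MKF) (α : Ordinal.{0}) : Prop :=
  a ∈ Y ∨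
  (∃ b c, α = 0 ∧ a = dEq b c ∧ b = c) ∨
  (∃ b c, α = 0 ∧ a = dNeg (dEq b c) ∧ b ≠ c) ∨
  (∃ b, α = 0 ∧ a = dNat b ∧ IsN b) ∨
  (∃ b, α = 0 ∧ a = dNeg (dNat b) ∧ ¬ IsN b) ∨
  (∃ b, a = dNeg (dNeg b) ∧ a ∉ Y ∧ b ∈ X) ∨
  (∃ b c, a = dAnd b c ∧ a ∉ Y ∧ b ∈ X ∧ c ∈ X) ∨
  (∃ b c, a = dNeg (dAnd b c) ∧ a ∉ Y ∧ (dNeg b ∈ X ∨ dNeg c ∈ X)) ∨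
  (∃ b c, a = dImp b c ∧ a ∉ Y ∧ (dNeg b ∈ X ∨ c ∈ X)) ∨
  (∃ b c, a = dNeg (dImp b c) ∧ a ∉ Y ∧ b ∈ X ∧ dNeg c ∈ X) ∨
  (∃ f, a = dAll f ∧ a ∉ Y ∧ ∀ x, f ⬝ x ∈ X) ∨
  (∃ f, a = dNeg (dAll f) ∧ a ∉ Y ∧ ∃ x, dNeg (f ⬝ x) ∈ X) ∨
  (∃ b c, IsSuc α ∧ a = lim b ⬝ c ∧ a ∉ Y ∧ dNeg a ∉ Y ∧ ClassIn Y b ∧ c ∈ Y) ∨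
  (∃ b c, IsSuc α ∧ a = dNeg (lim b ⬝ c) ∧ a ∉ Y ∧ dNeg a ∉ Y ∧ ClassIn Y b ∧ c ∉ Y)

theorem Phi_mono {X X' Y : Set MKF} {α : Ordinal.{0}} (h : X ⊆ X') {a : MKF}
    (ha : Phi X Y a α) : Phi X' Y a α := by
  have h' : ∀ {x}, x ∈ X → x ∈ X' := fun hx => h hx
  unfold Phi at ha ⊢
  rcases ha with ha | ha | ha | ha | ha | ⟨b, e, n, hb⟩ | ⟨b, c, e, n, hb, hc⟩ |
    ⟨b, c, e, n, hb⟩ | ⟨b, c, e, n, hb⟩ | ⟨b, c, e, n, hb, hc⟩ | ⟨f, e, n, hf⟩ |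
    ⟨f, e, n, x, hx⟩ | ha | ha
  · exact .inl ha
  · exact .inr (.inl ha)
  · exact .inr (.inr (.inl ha))
  · exact .inr (.inr (.inr (.inl ha)))
  · exact .inr (.inr (.inr (.inr (.inl ha))))
  · exact .inr (.inr (.inr (.inr (.inr (.inl ⟨b, e, n, h' hb⟩)))))
  · exact .inr (.inr (.inr (.inr (.inr (.inr (.inl ⟨b, c, e, n, h' hb, h' hc⟩))))))
  · exact .inr (.inr (.inr (.inr (.inr (.inr (.inr
      (.inl ⟨b, c, e, n, hb.imp h' h'⟩)))))))
  · exact .inr (.inr (.inr (.inr (.inr (.inr (.inr (.inr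
      (.inl ⟨b, c, e, n, hb.imp h' h'⟩))))))))
  · exact .inr (.inr (.inr (.inr (.inr (.inr (.inr (.inr (.inr
      (.inl ⟨b, c, e, n, h' hb, h' hc⟩)))))))))
  · exact .inr (.inr (.inr (.inr (.inr (.inr (.inr (.inr (.inr (.inr
      (.inl ⟨f, e, n, fun x => h' (hf x)⟩))))))))))
  · exact .inr (.inr (.inr (.inr (.inr (.inr (.inr (.inr (.inr (.inr (.inr
      (.inl ⟨f, e, n, x, h' hx⟩)))))))))))
  · exact .inr (.inr (.inr (.inr (.inr (.inr (.inr (.inr (.inr (.inr (.inr (.inr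
      (.inl ha))))))))))))
  · exact .inr (.inr (.inr (.inr (.inr (.inr (.inr (.inr (.inr (.inr (.inr (.inr
      (.inr ha))))))))))))

/-- `Φ(·, Y, ·, α)` as a monotone operator on sets. -/
def PhiHom (Y : Set MKF) (α : Ordinal.{0}) : Set MKF →o Set MKF where
  toFun X := {a | Phi X Y a α}
  monotone' _ _ h _ ha := Phi_mono h ha

/-- The sequence of least fixed points. -/
noncomputable def Z (α : Ordinal.{0}) : Set MKF :=
  Ordinal.limitRecOn α
    (OrderHom.lfp (PhiHom ∅ 0))
    (fun β Zβ => OrderHom.lfp (PhiHom Zβ (β + 1)))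
    (fun γ _ Zlt => OrderHom.lfp (PhiHom (⋃ (β : Ordinal.{0}) (h : β < γ), Zlt β h) γ))

theorem Z_zero : Z 0 = OrderHom.lfp (PhiHom ∅ 0) := by
  simp [Z]

theorem Z_succ (α : Ordinal.{0}) : Z (α + 1) = OrderHom.lfp (PhiHom (Z α) (α + 1)) := by
  simp [Z]

theorem Z_limit {γ : Ordinal.{0}} (h : Order.IsSuccLimit γ) :
    Z γ = OrderHom.lfp (PhiHom (⋃ β < γ, Z β) γ) := by
  simp only [Z, Ordinal.limitRecOn_limit _ _ _ _ h]

theorem subset_lfp (Y : Set MKF) (α : Ordinal.{0}) : Y ⊆ OrderHom.lfp (PhiHom Y α) := by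
  intro a ha
  rw [← OrderHom.map_lfp]
  exact Or.inl ha

theorem Z_mono {α β : Ordinal.{0}} (h : α ≤ β) : Z α ⊆ Z β := by
  induction β using Ordinal.limitRecOn with
  | zero => rw [le_antisymm h (zero_le)]
  | add_one β ih =>
    rcases h.lt_or_eq with h | rfl
    · rw [Z_succ]
      exact (ih (Order.lt_add_one_iff.1 h)).trans (subset_lfp _ _)
    · exact subset_rfl
  | limit γ hγ ih =>
    rcases h.lt_or_eq with h | rfl
    · rw [Z_limit hγ]
      exact (Set.subset_iUnion₂ (s := fun β (_ : β < γ) => Z β) α h).trans (subset_lfp _ _)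
    · exact subset_rfl

theorem exists_final_stage : {α : Ordinal.{0} | Z α = Z (α + 1)}.Nonempty := by
  by_contra hne
  have hne' : ∀ α, Z α ≠ Z (α + 1) := fun α h => hne ⟨α, h⟩
  have key : ∀ α β : Ordinal.{0}, α < β → Z α ≠ Z β := fun α β h e =>
    hne' α (subset_antisymm (Z_mono (Order.le_succ α))
      ((Z_mono (Order.add_one_le_of_lt h)).trans e.symm.subset))
  exact not_injective_of_ordinal Z fun α β e => by
    rcases lt_trichotomy α β with h | h | h
    · exact absurd e (key _ _ h)
    · exact h
    · exact absurd e.symm (key _ _ h)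

/-- The least `ι` with `Z_ι = Z_(ι+1)`. -/
noncomputable def iota : Ordinal.{0} := sInf {α : Ordinal.{0} | Z α = Z (α + 1)}

/-- `iota` is indeed the least such ordinal. -/
theorem iota_isLeast : IsLeast {α : Ordinal.{0} | Z α = Z (α + 1)} iota :=
  ⟨csInf_mem exists_final_stage, fun _ h => csInf_le' h⟩

/-- The interpretation of `T`. -/
def IsT (a : MKF) : Prop := a ∈ Z iota

/-- The interpretation of `U`. -/
def IsU (u : MKF) : Prop := ∃ f : MKF, u = lim f ∧ ClassIn (Z iota) f

/-- Kahle's model. -/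
instance : LFS.Structure MKF where
  funMap f xs := match f with
    | FSFunc.const c => cst c
    | FSFunc.app => xs 0 ⬝ xs 1
  RelMap r xs := match r with
    | FSRel.N => IsN (xs 0)
    | FSRel.T => IsT (xs 0)
    | FSRel.U => IsU (xs 0)

/-! ## Formulas -/

/-- Terms in the variables `v 0, …, v (n - 1)`. -/
abbrev Tm (n : ℕ) : Type := LFS.Term (Empty ⊕ Fin n)

/-- Formulas in the free variables `v 0, …, v (n - 1)`; a quantifier in front of a formula of
`Fm (n + 1)` binds `v n`, and `alls` is the universal closure. -/
abbrev Fm (n : ℕ) : Type := LFS.BoundedFormula Empty n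

/-- The variable with index `i`. -/
def v {n : ℕ} (i : ℕ) (h : i < n := by omega) : Tm n := Term.var (Sum.inr ⟨i, h⟩)

def fN {n : ℕ} (t : Tm n) : Fm n := Relations.boundedFormula₁ (L := LFS) FSRel.N t

def fT {n : ℕ} (t : Tm n) : Fm n := Relations.boundedFormula₁ (L := LFS) FSRel.T t

def fU {n : ℕ} (t : Tm n) : Fm n := Relations.boundedFormula₁ (L := LFS) FSRel.U t

/-- `P(t)`: `t` is a proposition. -/
def fP {n : ℕ} (t : Tm n) : Fm n := fT t ⊔ fT (dNeg t)

/-- `B(t)`, the result of substituting `t` for the last variable of `B`, while the other variables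
(the parameters) `0, …, n - 1` of `B` become `v 0, …, v (n - 1)`. -/
def inst {n m : ℕ} (B : LFS.Formula (Fin (n + 1))) (t : Tm m) (h : n ≤ m := by omega) : Fm m :=
  BoundedFormula.relabel (k := 0) (id : Empty ⊕ Fin m → Empty ⊕ Fin m)
    (BoundedFormula.subst B
      (Fin.lastCases (motive := fun _ => Tm m) t fun i => v i (lt_of_lt_of_le i.2 h)))

/-! ## The theories -/

/-- Induction on `N` for the formula `A`, with parameters. -/
def indAx {n : ℕ} (A : LFS.Formula (Fin (n + 1))) : LFS.Sentence :=
  ((inst A (cst .zero) ⊓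
      ∀' (fN (v n) ⊓ inst A (v n) ⟹ inst A (cst .sN ⬝ v n))) ⟹
    ∀' (fN (v n) ⟹ inst A (v n)) : Fm n).alls

/-- The axioms of the total applicative theory, with induction for all formulas of the language of
Frege structures. -/
inductive TON : LFS.Sentence → Prop
  | k : TON (cst .k ⬝ v 0 ⬝ v 1 =' v 0 : Fm 2).alls
  | s : TON (cst .s ⬝ v 0 ⬝ v 1 ⬝ v 2 =' v 0 ⬝ v 2 ⬝ (v 1 ⬝ v 2) : Fm 3).alls
  | pair : TON ((cst .p0 ⬝ pair (v 0) (v 1) =' v 0) ⊓ (cst .p1 ⬝ pair (v 0) (v 1) =' v 1) :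
      Fm 2).alls
  | nat : TON (fN (cst .zero) ⊓ ∀' (fN (v 0) ⟹ fN (cst .sN ⬝ v 0)) : Fm 0).alls
  | succ : TON (∀' (fN (v 0) ⟹
      ∼(cst .sN ⬝ v 0 =' cst .zero) ⊓ (cst .pN ⬝ (cst .sN ⬝ v 0) =' v 0)) : Fm 0).alls
  | pred : TON (∀' (fN (v 0) ⊓ ∼(v 0 =' cst .zero) ⟹
      fN (cst .pN ⬝ v 0) ⊓ (cst .sN ⬝ (cst .pN ⬝ v 0) =' v 0)) : Fm 0).alls
  | dN_eq : TON (fN (v 0) ⊓ fN (v 1) ⊓ (v 0 =' v 1) ⟹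
      (cst .dN ⬝ v 2 ⬝ v 3 ⬝ v 0 ⬝ v 1 =' v 2) : Fm 4).alls
  | dN_ne : TON (fN (v 0) ⊓ fN (v 1) ⊓ ∼(v 0 =' v 1) ⟹
      (cst .dN ⬝ v 2 ⬝ v 3 ⬝ v 0 ⬝ v 1 =' v 3) : Fm 4).alls
  | ind {n : ℕ} (A : LFS.Formula (Fin (n + 1))) : TON (indAx A)

/-- The truth axioms of `KF`. -/
inductive KFTruth : LFS.Sentence → Prop
  | eq : KFTruth (fT (dEq (v 0) (v 1)) ⇔ (v 0 =' v 1) : Fm 2).alls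
  | ne : KFTruth (fT (dNeg (dEq (v 0) (v 1))) ⇔ ∼(v 0 =' v 1) : Fm 2).alls
  | nat : KFTruth (fT (dNat (v 0)) ⇔ fN (v 0) : Fm 1).alls
  | not_nat : KFTruth (fT (dNeg (dNat (v 0))) ⇔ ∼(fN (v 0)) : Fm 1).alls
  | not_not : KFTruth (fT (dNeg (dNeg (v 0))) ⇔ fT (v 0) : Fm 1).alls
  | and : KFTruth (fT (dAnd (v 0) (v 1)) ⇔ (fT (v 0) ⊓ fT (v 1)) : Fm 2).alls
  | not_and : KFTruth (fT (dNeg (dAnd (v 0) (v 1))) ⇔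
      (fT (dNeg (v 0)) ⊔ fT (dNeg (v 1))) : Fm 2).alls
  | imp : KFTruth (fT (dImp (v 0) (v 1)) ⇔ (fT (dNeg (v 0)) ⊔ fT (v 1)) : Fm 2).alls
  | not_imp : KFTruth (fT (dNeg (dImp (v 0) (v 1))) ⇔ (fT (v 0) ⊓ fT (dNeg (v 1))) : Fm 2).alls
  | all : KFTruth (fT (dAll (v 0)) ⇔ ∀' fT (v 0 ⬝ v 1) : Fm 1).alls
  | not_all : KFTruth (fT (dNeg (dAll (v 0))) ⇔ ∃' fT (dNeg (v 0 ⬝ v 1)) : Fm 1).alls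
  | cons : KFTruth (∼(fT (v 0) ⊓ fT (dNeg (v 0))) : Fm 1).alls

/-- The theory `KF`. -/
def KF : LFS.Theory := {φ | TON φ ∨ KFTruth φ}

/-- `C(f)`, for `f` the variable with index `i`: `f x` is a proposition for every `x`. -/
def fC {n : ℕ} (i : ℕ) (h : i < n := by omega) : Fm n := ∀' fP (v i ⬝ v n)

/-- The universe axioms of `KFU`; in each of them the universe is `v 0`. -/
inductive KFUniv : LFS.Sentence → Prop
  | eq : KFUniv (fU (v 0) ⟹ ∀' ∀' (fT (v 0 ⬝ dEq (v 1) (v 2)) ⇔ (v 1 =' v 2)) : Fm 1).alls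
  | ne : KFUniv (fU (v 0) ⟹
      ∀' ∀' (fT (v 0 ⬝ dNeg (dEq (v 1) (v 2))) ⇔ ∼(v 1 =' v 2)) : Fm 1).alls
  | nat : KFUniv (fU (v 0) ⟹ ∀' (fT (v 0 ⬝ dNat (v 1)) ⇔ fN (v 1)) : Fm 1).alls
  | not_nat : KFUniv (fU (v 0) ⟹
      ∀' (fT (v 0 ⬝ dNeg (dNat (v 1))) ⇔ ∼(fN (v 1))) : Fm 1).alls
  | not_not : KFUniv (fU (v 0) ⟹
      ∀' (fT (v 0 ⬝ dNeg (dNeg (v 1))) ⇔ fT (v 0 ⬝ v 1)) : Fm 1).alls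
  | and : KFUniv (fU (v 0) ⟹
      ∀' ∀' (fT (v 0 ⬝ dAnd (v 1) (v 2)) ⇔ (fT (v 0 ⬝ v 1) ⊓ fT (v 0 ⬝ v 2))) : Fm 1).alls
  | not_and : KFUniv (fU (v 0) ⟹
      ∀' ∀' (fT (v 0 ⬝ dNeg (dAnd (v 1) (v 2))) ⇔
        (fT (v 0 ⬝ dNeg (v 1)) ⊔ fT (v 0 ⬝ dNeg (v 2)))) : Fm 1).alls
  | imp : KFUniv (fU (v 0) ⟹
      ∀' ∀' (fT (v 0 ⬝ dImp (v 1) (v 2)) ⇔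
        (fT (v 0 ⬝ dNeg (v 1)) ⊔ fT (v 0 ⬝ v 2))) : Fm 1).alls
  | not_imp : KFUniv (fU (v 0) ⟹
      ∀' ∀' (fT (v 0 ⬝ dNeg (dImp (v 1) (v 2))) ⇔
        (fT (v 0 ⬝ v 1) ⊓ fT (v 0 ⬝ dNeg (v 2)))) : Fm 1).alls
  | all : KFUniv (fU (v 0) ⟹
      ∀' (fT (v 0 ⬝ dAll (v 1)) ⇔ ∀' fT (v 0 ⬝ (v 1 ⬝ v 2))) : Fm 1).alls
  | not_all : KFUniv (fU (v 0) ⟹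
      ∀' (fT (v 0 ⬝ dNeg (dAll (v 1))) ⇔ ∃' fT (v 0 ⬝ dNeg (v 1 ⬝ v 2))) : Fm 1).alls
  | cons : KFUniv (fU (v 0) ⟹
      ∀' ∼(fT (v 0 ⬝ v 1) ⊓ fT (v 0 ⬝ dNeg (v 1))) : Fm 1).alls
  | cls : KFUniv (fU (v 0) ⟹ fC 0 : Fm 1).alls
  | true : KFUniv (fU (v 0) ⟹ ∀' (fT (v 0 ⬝ v 1) ⟹ fT (v 1)) : Fm 1).alls
  -- `C(f) → U(l f)` and `l f` reflects on `f`
  | lim : KFUniv (fC 0 ⟹ fU (lim (v 0)) ⊓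
      ((∀' (fT (v 0 ⬝ v 1) ⟹ fT (lim (v 0) ⬝ (v 0 ⬝ v 1)))) ⊓
       (∀' (fT (dNeg (v 0 ⬝ v 1)) ⟹ fT (lim (v 0) ⬝ dNeg (v 0 ⬝ v 1))))) : Fm 1).alls

/-- The theory `KFU`. -/
def KFU : LFS.Theory := {φ | TON φ ∨ KFUniv φ}

/-- The constants `≐, ¬̇, ∧̇, →̇, ∀̇, Ṅ, l`. -/
def Generator (c : Const) : Prop :=
  c = .eqC ∨ c = .negC ∨ c = .andC ∨ c = .impC ∨ c = .allC ∨ c = .natC ∨ c = .l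

/-- Unique generation: terms built by the generators (applied to one argument, and `l` also to two)
are uniquely decomposed. -/
inductive UG : LFS.Sentence → Prop
  | const_ne (c d : Const) : Generator c → Generator d → c ≠ d →
      UG (∼(cst c =' cst d) : Fm 0).alls
  | app_ne_const (c d : Const) : Generator c → Generator d →
      UG (∼(cst c ⬝ v 0 =' cst d) : Fm 1).alls
  | app_ne (c d : Const) : Generator c → Generator d → c ≠ d →
      UG (∼(cst c ⬝ v 0 =' cst d ⬝ v 1) : Fm 2).alls
  | app_inj (c : Const) : Generator c →
      UG ((cst c ⬝ v 0 =' cst c ⬝ v 1) ⟹ (v 0 =' v 1) : Fm 2).alls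
  | lim_ne_const (c : Const) : Generator c → UG (∼(lim (v 0) ⬝ v 1 =' cst c) : Fm 2).alls
  | lim_ne_app (c : Const) : Generator c → UG (∼(lim (v 0) ⬝ v 1 =' cst c ⬝ v 2) : Fm 3).alls
  | lim_inj : UG ((lim (v 0) ⬝ v 1 =' lim (v 2) ⬝ v 3) ⟹ (v 0 =' v 2) ⊓ (v 1 =' v 3) : Fm 4).alls

/-- `𝒜(B(•), x)`, where `x` is `v n` and `v 0, …, v (n - 1)` are the parameters of `B`. -/
def opA {n : ℕ} (B : LFS.Formula (Fin (n + 1))) : Fm (n + 1) :=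
  (∃' ∃' (v n =' dEq (v (n + 1)) (v (n + 2)))) ⊔
  (∃' (v n =' dNat (v (n + 1)))) ⊔
  (∃' ((v n =' dNeg (v (n + 1))) ⊓ inst B (v (n + 1)))) ⊔
  (∃' ∃' ((v n =' dAnd (v (n + 1)) (v (n + 2))) ⊓
    ((inst B (v (n + 1)) ⊓ inst B (v (n + 2))) ⊔
     (inst B (v (n + 1)) ⊓ fT (dNeg (v (n + 1)))) ⊔
     (inst B (v (n + 2)) ⊓ fT (dNeg (v (n + 2))))))) ⊔
  (∃' ∃' ((v n =' dImp (v (n + 1)) (v (n + 2))) ⊓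
    ((inst B (v (n + 1)) ⊓ inst B (v (n + 2))) ⊔
     (inst B (v (n + 1)) ⊓ fT (dNeg (v (n + 1)))) ⊔
     (inst B (v (n + 2)) ⊓ fT (v (n + 2)))))) ⊔
  (∃' ((v n =' dAll (v (n + 1))) ⊓
    ((∀' inst B (v (n + 1) ⬝ v (n + 2))) ⊔
     (∃' (inst B (v (n + 1) ⬝ v (n + 2)) ⊓ fT (dNeg (v (n + 1) ⬝ v (n + 2)))))))) ⊔
  (∃' ∃' ((v n =' lim (v (n + 1)) ⬝ v (n + 2)) ⊓ ∀' inst B (v (n + 1) ⬝ v (n + 3))))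

/-- Proposition induction for the formula `B`, with parameters. -/
def propInd {n : ℕ} (B : LFS.Formula (Fin (n + 1))) : LFS.Sentence :=
  ((∀' (opA B ⟹ inst B (v n))) ⟹ ∀' (fP (v n) ⟹ inst B (v n)) : Fm n).alls

/-- The schema of proposition induction. -/
def PI : LFS.Theory := {φ | ∃ (n : ℕ) (B : LFS.Formula (Fin (n + 1))), φ = propInd B}

/-- The theory `KFUPI`. -/
def KFUPI : LFS.Theory := KFU ∪ {φ | UG φ} ∪ PI

end FregeStructure

namespace FregeStructure

/-! ## Closed terms -/

/-! Everything rests on two facts: reduction is confluent, and truth is consistent at every stage.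

Confluence is proved with parallel reduction and complete developments (`Par.triangle`). Terms
headed by the constants of Frege structures are never root redexes, so convertible ones have a
common reduct that still shows the head and the arguments. This yields unique generation, and hence
at most one clause of `Phi` besides membership in Y can produce an element of a given shape. Looking
at the first stage at which an element appears, one gets the compositional truth clauses for every
`Z α`, not only for `Z iota`.

An element `lim b ⬝ c` or its negation enters only at a successor stage β + 1 where b is already a
class in `Z β`, and never once either of the two has been decided; so both cannot be true
(`lim_mem_elim`). The other shapes are handled by induction inside a stage and over the stages
(`Z_consistent`). If f is a class at the end and β is the least stage at which it is one, then `lim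
f` is decided on all arguments at β + 1, and `lim f ⬝ c` says exactly that c belongs to `Z β`
(`exists_stage_of_class`). A universe is thus an earlier stage of truth, and its axioms are the
truth clauses at β together with monotonicity.

Proposition induction is the induction generating the stages: what enters as true or false has
constituents to which an earlier step applies, and these are the constituents asked for by 𝒜
(`prop_induction_stage`). -/

theorem ClosedTerm.app_inj {a b a' b' : ClosedTerm} : a ⬝ b = a' ⬝ b' ↔ a = a' ∧ b = b' := by
  constructor
  · intro h
    have h' := (Term.func.inj h).2.2
    have h'' := eq_of_heq h'
    exact ⟨by simpa using congrFun h'' 0, by simpa using congrFun h'' 1⟩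
  · rintro ⟨rfl, rfl⟩; rfl

theorem ClosedTerm.cst_inj {c d : Const} : (cst c : ClosedTerm) = cst d ↔ c = d := by
  constructor
  · intro h
    have h' := eq_of_heq (Term.func.inj h).2.1
    exact FSFunc.const.inj h'
  · rintro rfl; rfl

theorem ClosedTerm.cst_ne_app {c : Const} {a b : ClosedTerm} : (cst c : ClosedTerm) ≠ a ⬝ b := by
  intro h
  have h' := (Term.func.inj h).1
  exact absurd h' (by decide)

theorem ClosedTerm.app_ne_cst {c : Const} {a b : ClosedTerm} : a ⬝ b ≠ (cst c : ClosedTerm) :=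
  ClosedTerm.cst_ne_app.symm

theorem ClosedTerm.induction {motive : ClosedTerm → Prop} (const : ∀ c, motive (cst c))
    (app : ∀ a b, motive a → motive b → motive (a ⬝ b)) : ∀ t, motive t
  | .var x => x.elim
  | .func f ts => by
    have ih := fun i => ClosedTerm.induction const app (ts i)
    rename_i l
    cases f with
    | const c =>
      have : ts = default := Subsingleton.elim _ _
      rw [this]
      exact const c
    | app =>
      have : ts = ![ts 0, ts 1] := by ext i; fin_cases i <;> rfl
      rw [this]
      exact app _ _ (ih 0) (ih 1)

theorem num_inj : ∀ {m n : ℕ}, (num m : ClosedTerm) = num n → m = n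
  | 0, 0, _ => rfl
  | 0, _ + 1, h => (ClosedTerm.cst_ne_app h).elim
  | _ + 1, 0, h => (ClosedTerm.app_ne_cst h).elim
  | _ + 1, _ + 1, h => congrArg _ (num_inj (ClosedTerm.app_inj.1 h).2)

/-! ## Parallel reduction and confluence -/

/-- Contracting several redexes at once restores the diamond property in one step, which `Red` lacks
because `s` duplicates its third argument. Discarded arguments are left alone, and numerals inside a
redex need no reduction of their own since they are normal. -/
inductive Par : ClosedTerm → ClosedTerm → Prop
  | const (c : Const) : Par (cst c) (cst c)
  | app {a a' b b' : ClosedTerm} : Par a a' → Par b b' → Par (a ⬝ b) (a' ⬝ b')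
  | k {a a' : ClosedTerm} (b : ClosedTerm) : Par a a' → Par (cst .k ⬝ a ⬝ b) a'
  | s {a a' b b' c c' : ClosedTerm} : Par a a' → Par b b' → Par c c' →
      Par (cst .s ⬝ a ⬝ b ⬝ c) (a' ⬝ c' ⬝ (b' ⬝ c'))
  | p0 {a a' : ClosedTerm} (b : ClosedTerm) : Par a a' → Par (cst .p0 ⬝ (cst .p ⬝ a ⬝ b)) a'
  | p1 {b b' : ClosedTerm} (a : ClosedTerm) : Par b b' → Par (cst .p1 ⬝ (cst .p ⬝ a ⬝ b)) b'
  | pN (n : ℕ) : Par (cst .pN ⬝ (cst .sN ⬝ num n)) (num n)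
  | dN_eq {u u' : ClosedTerm} (v : ClosedTerm) (n : ℕ) : Par u u' →
      Par (cst .dN ⬝ u ⬝ v ⬝ num n ⬝ num n) u'
  | dN_ne {v v' : ClosedTerm} (u : ClosedTerm) (m n : ℕ) : m ≠ n → Par v v' →
      Par (cst .dN ⬝ u ⬝ v ⬝ num m ⬝ num n) v'

theorem Par.refl (t : ClosedTerm) : Par t t :=
  ClosedTerm.induction (motive := fun t => Par t t) .const (fun _ _ => .app) t

theorem Red.par {a b : ClosedTerm} (h : Red a b) : Par a b := by
  induction h with
  | k a b => exact .k _ (.refl _)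
  | s a b c => exact .s (.refl _) (.refl _) (.refl _)
  | p0 a b => exact .p0 _ (.refl _)
  | p1 a b => exact .p1 _ (.refl _)
  | pN n => exact .pN n
  | dN_eq u v n => exact .dN_eq _ _ (.refl _)
  | dN_ne u v m n h => exact .dN_ne _ _ _ h (.refl _)
  | appL b _ ih => exact .app ih (.refl _)
  | appR a _ ih => exact .app (.refl _) ih

theorem Par.cst_inv {c : Const} {x : ClosedTerm} (h : Par (cst c) x) : x = cst c := by
  generalize e : (cst c : ClosedTerm) = t at h
  cases h <;> first | exact e.symm ▸ rfl | exact (ClosedTerm.cst_ne_app e).elim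

theorem Par.app_inv {a b x : ClosedTerm} (h : Par (a ⬝ b) x) :
    (∃ a' b', x = a' ⬝ b' ∧ Par a a' ∧ Par b b') ∨
    (∃ a₀, a = cst .k ⬝ a₀ ∧ Par a₀ x) ∨
    (∃ f g f' g' b', a = cst .s ⬝ f ⬝ g ∧ x = f' ⬝ b' ⬝ (g' ⬝ b') ∧
      Par f f' ∧ Par g g' ∧ Par b b') ∨
    (∃ y z, a = cst .p0 ∧ b = cst .p ⬝ y ⬝ z ∧ Par y x) ∨
    (∃ y z, a = cst .p1 ∧ b = cst .p ⬝ y ⬝ z ∧ Par z x) ∨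
    (∃ n : ℕ, a = cst .pN ∧ b = cst .sN ⬝ num n ∧ x = num n) ∨
    (∃ (u v : ClosedTerm) (n : ℕ), a = cst .dN ⬝ u ⬝ v ⬝ num n ∧ b = num n ∧ Par u x) ∨
    (∃ (u v : ClosedTerm) (m n : ℕ), a = cst .dN ⬝ u ⬝ v ⬝ num m ∧ b = num n ∧ m ≠ n ∧
      Par v x) := by
  -- Application is a defined operation on terms, not a constructor, so the index is replaced by a
  -- variable and the equation is solved by `ClosedTerm.app_inj`.
  generalize e : a ⬝ b = t at h
  cases h with
  | const c => exact (ClosedTerm.app_ne_cst e).elim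
  | app h h' =>
    obtain ⟨rfl, rfl⟩ := ClosedTerm.app_inj.1 e
    exact .inl ⟨_, _, rfl, h, h'⟩
  | k b h =>
    obtain ⟨rfl, rfl⟩ := ClosedTerm.app_inj.1 e
    exact .inr (.inl ⟨_, rfl, h⟩)
  | s h h' h'' =>
    obtain ⟨rfl, rfl⟩ := ClosedTerm.app_inj.1 e
    exact .inr (.inr (.inl ⟨_, _, _, _, _, rfl, rfl, h, h', h''⟩))
  | p0 b h =>
    obtain ⟨rfl, rfl⟩ := ClosedTerm.app_inj.1 e
    exact .inr (.inr (.inr (.inl ⟨_, _, rfl, rfl, h⟩)))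
  | p1 b h =>
    obtain ⟨rfl, rfl⟩ := ClosedTerm.app_inj.1 e
    exact .inr (.inr (.inr (.inr (.inl ⟨_, _, rfl, rfl, h⟩))))
  | pN n =>
    obtain ⟨rfl, rfl⟩ := ClosedTerm.app_inj.1 e
    exact .inr (.inr (.inr (.inr (.inr (.inl ⟨_, rfl, rfl, rfl⟩)))))
  | dN_eq v n h =>
    obtain ⟨rfl, rfl⟩ := ClosedTerm.app_inj.1 e
    exact .inr (.inr (.inr (.inr (.inr (.inr (.inl ⟨_, _, _, rfl, rfl, h⟩))))))
  | dN_ne u m n hmn h =>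
    obtain ⟨rfl, rfl⟩ := ClosedTerm.app_inj.1 e
    exact .inr (.inr (.inr (.inr (.inr (.inr (.inr ⟨_, _, _, _, rfl, rfl, hmn, h⟩))))))

/-- Constants whose application to one argument is never a redex. -/
def InertOne (c : Const) : Prop := c ≠ .p0 ∧ c ≠ .p1 ∧ c ≠ .pN

/-- Constants whose application to two arguments is never a redex. -/
def InertTwo (c : Const) : Prop := InertOne c ∧ c ≠ .k

theorem Par.cst_app_inv {c : Const} {a x : ClosedTerm} (hc : InertOne c)
    (h : Par (cst c ⬝ a) x) : ∃ a', x = cst c ⬝ a' ∧ Par a a' := by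
  obtain ⟨h1, h2, h3⟩ := hc
  rcases h.app_inv with ⟨a', b', rfl, h, h'⟩ | h
  · rw [h.cst_inv]
    exact ⟨_, rfl, h'⟩
  · simp [ClosedTerm.cst_ne_app, ClosedTerm.cst_inj, h1, h2, h3] at h

theorem Par.cst_app₂_inv {c : Const} {a b x : ClosedTerm} (hc : InertTwo c)
    (h : Par (cst c ⬝ a ⬝ b) x) : ∃ a' b', x = cst c ⬝ a' ⬝ b' ∧ Par a a' ∧ Par b b' := by
  rcases h.app_inv with ⟨a', b', rfl, h, h'⟩ | h
  · obtain ⟨a', rfl, h''⟩ := h.cst_app_inv hc.1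
    exact ⟨_, _, rfl, h'', h'⟩
  · simp [ClosedTerm.cst_ne_app, ClosedTerm.app_ne_cst, ClosedTerm.app_inj, ClosedTerm.cst_inj,
      hc.2] at h

theorem Par.dN_app₂_inv {a b x : ClosedTerm} (h : Par (cst .dN ⬝ a ⬝ b) x) :
    ∃ a' b', x = cst .dN ⬝ a' ⬝ b' ∧ Par a a' ∧ Par b b' :=
  h.cst_app₂_inv (by simp [InertTwo, InertOne])

/-- Normality of numerals makes the rules for `dN` harmless, although they compare two arguments: a
reduction inside the redex cannot destroy the comparison. -/
theorem Par.num_inv {n : ℕ} {x : ClosedTerm} (h : Par (num n) x) : x = num n := by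
  induction n generalizing x with
  | zero => exact h.cst_inv
  | succ n ih =>
    obtain ⟨a', rfl, h'⟩ := Par.cst_app_inv (by simp [InertOne]) h
    rw [ih h']; rfl

theorem Par.dN_app₃_inv {a b x : ClosedTerm} {n : ℕ} (h : Par (cst .dN ⬝ a ⬝ b ⬝ num n) x) :
    ∃ a' b', x = cst .dN ⬝ a' ⬝ b' ⬝ num n ∧ Par a a' ∧ Par b b' := by
  rcases h.app_inv with ⟨a', b', rfl, h, h'⟩ | h
  · obtain ⟨a', b', rfl, h, h''⟩ := h.dN_app₂_inv
    exact ⟨_, _, by rw [h'.num_inv], h, h''⟩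
  · simp [ClosedTerm.cst_ne_app, ClosedTerm.app_ne_cst, ClosedTerm.app_inj, ClosedTerm.cst_inj] at h

/-- If `a ⬝ b` is a redex, the complete development is the contractum built from developments of the
arguments; otherwise it is `a₁ ⬝ b₁`. Developments of the arguments are read off from `a₁` and `b₁`
by inversion, so the hypotheses on a and b alone suffice. -/
theorem Par.app_triangle {a b a₁ b₁ : ClosedTerm} (ha : ∀ u, Par a u → Par u a₁)
    (hb : ∀ u, Par b u → Par u b₁) : ∃ w, ∀ u, Par (a ⬝ b) u → Par u w := by
  have ha₁ := ha _ (.refl a)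
  have hb₁ := hb _ (.refl b)
  by_cases hk : ∃ a₀, a = cst .k ⬝ a₀
  · obtain ⟨a₀, rfl⟩ := hk
    obtain ⟨w, rfl, -⟩ := ha₁.cst_app_inv (by simp [InertOne])
    -- The development property of `a`, applied to the congruence step that only reduces `a₀`,
    -- passes to `a₀`. The other redexes use the same device.
    have hw : ∀ u, Par a₀ u → Par u w := fun u hu => by
      obtain ⟨_, e, h⟩ := (ha _ (.app (.refl _) hu)).cst_app_inv (by simp [InertOne])
      exact (ClosedTerm.app_inj.1 e).2 ▸ h
    refine ⟨w, fun u hu => ?_⟩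
    rcases hu.app_inv with ⟨a', b', rfl, h, h'⟩ | h
    · obtain ⟨a', rfl, h''⟩ := h.cst_app_inv (by simp [InertOne])
      exact .k _ (hw _ h'')
    · simp [ClosedTerm.cst_ne_app, ClosedTerm.app_ne_cst, ClosedTerm.app_inj] at h
      exact hw _ h
  by_cases hs : ∃ f g, a = cst .s ⬝ f ⬝ g
  · obtain ⟨f, g, rfl⟩ := hs
    obtain ⟨f₁, g₁, rfl, -, -⟩ := ha₁.cst_app₂_inv (by simp [InertTwo, InertOne])
    have hw : ∀ u v, Par f u → Par g v → Par u f₁ ∧ Par v g₁ := fun u v hu hv => by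
      obtain ⟨_, _, e, h, h'⟩ := (ha _ (.app (.app (.refl _) hu) hv)).cst_app₂_inv
        (by simp [InertTwo, InertOne])
      simp only [ClosedTerm.app_inj, true_and] at e
      exact ⟨e.1 ▸ h, e.2 ▸ h'⟩
    refine ⟨f₁ ⬝ b₁ ⬝ (g₁ ⬝ b₁), fun u hu => ?_⟩
    rcases hu.app_inv with ⟨a', b', rfl, h, h'⟩ | h
    · obtain ⟨f', g', rfl, hf, hg⟩ := h.cst_app₂_inv (by simp [InertTwo, InertOne])
      exact .s (hw _ _ hf hg).1 (hw _ _ hf hg).2 (hb _ h')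
    · simp [ClosedTerm.cst_ne_app, ClosedTerm.app_ne_cst, ClosedTerm.app_inj] at h
      obtain ⟨f', g', b', rfl, hf, hg, h'⟩ := h
      have := hw _ _ hf hg
      exact .app (.app this.1 (hb _ h')) (.app this.2 (hb _ h'))
  by_cases hp : ∃ y z, (a = cst .p0 ∨ a = cst .p1) ∧ b = cst .p ⬝ y ⬝ z
  · obtain ⟨y, z, ha', rfl⟩ := hp
    obtain ⟨y₁, z₁, rfl, -, -⟩ := hb₁.cst_app₂_inv (by simp [InertTwo, InertOne])
    have hw : ∀ u v, Par y u → Par z v → Par u y₁ ∧ Par v z₁ := fun u v hu hv => by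
      obtain ⟨_, _, e, h, h'⟩ := (hb _ (.app (.app (.refl _) hu) hv)).cst_app₂_inv
        (by simp [InertTwo, InertOne])
      simp only [ClosedTerm.app_inj, true_and] at e
      exact ⟨e.1 ▸ h, e.2 ▸ h'⟩
    rcases ha' with rfl | rfl
    · refine ⟨y₁, fun u hu => ?_⟩
      rcases hu.app_inv with ⟨a', b', rfl, h, h'⟩ | h
      · obtain ⟨f', g', rfl, hf, hg⟩ := h'.cst_app₂_inv (by simp [InertTwo, InertOne])
        rw [h.cst_inv]
        exact .p0 _ (hw _ _ hf hg).1
      · simp [ClosedTerm.cst_ne_app, ClosedTerm.app_inj, ClosedTerm.cst_inj] at h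
        exact (hw _ _ h (.refl _)).1
    · refine ⟨z₁, fun u hu => ?_⟩
      rcases hu.app_inv with ⟨a', b', rfl, h, h'⟩ | h
      · obtain ⟨f', g', rfl, hf, hg⟩ := h'.cst_app₂_inv (by simp [InertTwo, InertOne])
        rw [h.cst_inv]
        exact .p1 _ (hw _ _ hf hg).2
      · simp [ClosedTerm.cst_ne_app, ClosedTerm.app_inj, ClosedTerm.cst_inj] at h
        exact (hw _ _ (.refl _) h).2
  by_cases hN : ∃ n : ℕ, a = cst .pN ∧ b = cst .sN ⬝ num n
  · obtain ⟨n, rfl, rfl⟩ := hN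
    refine ⟨num n, fun u hu => ?_⟩
    rcases hu.app_inv with ⟨a', b', rfl, h, h'⟩ | h
    · rw [h.cst_inv, Par.num_inv (n := n + 1) h']
      exact .pN n
    · simp [ClosedTerm.cst_ne_app, ClosedTerm.app_inj, ClosedTerm.cst_inj] at h
      obtain ⟨m, e, rfl⟩ := h
      rw [e]
      exact .refl _
  by_cases hd : ∃ (u v : ClosedTerm) (m n : ℕ), a = cst .dN ⬝ u ⬝ v ⬝ num m ∧ b = num n
  · obtain ⟨x, y, m, n, rfl, rfl⟩ := hd
    obtain ⟨x₁, y₁, rfl, -, -⟩ := ha₁.dN_app₃_inv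
    have hw : ∀ u v, Par x u → Par y v → Par u x₁ ∧ Par v y₁ := fun u v hu hv => by
      obtain ⟨_, _, e, h, h'⟩ := (ha _ (.app (.app (.app (.refl _) hu) hv) (.refl _))).dN_app₃_inv
      simp only [ClosedTerm.app_inj, true_and, and_true] at e
      exact ⟨e.1 ▸ h, e.2 ▸ h'⟩
    refine ⟨if m = n then x₁ else y₁, fun u hu => ?_⟩
    rcases hu.app_inv with ⟨a', b', rfl, h, h'⟩ | h
    · obtain ⟨f', g', rfl, hf, hg⟩ := h.dN_app₃_inv
      rw [h'.num_inv]
      split_ifs with hmn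
      · subst hmn
        exact .dN_eq _ _ (hw _ _ hf hg).1
      · exact .dN_ne _ _ _ hmn (hw _ _ hf hg).2
    · simp only [ClosedTerm.app_ne_cst, ClosedTerm.app_inj, false_and, exists_false, false_or,
        true_and] at h
      rcases h with ⟨u', v', k, ⟨⟨rfl, rfl⟩, e⟩, e', h⟩ | ⟨u', v', k, l, ⟨⟨rfl, rfl⟩, e⟩, e', hkl, h⟩
      · rw [if_pos ((num_inj e).trans (num_inj e').symm)]
        exact (hw _ _ h (.refl _)).1
      · rw [if_neg (by rw [num_inj e, num_inj e']; exact hkl)]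
        exact (hw _ _ (.refl _) h).2
  -- All redex patterns are now excluded, so only the congruence step remains.
  refine ⟨a₁ ⬝ b₁, fun u hu => ?_⟩
  rcases hu.app_inv with ⟨a', b', rfl, h, h'⟩ | ⟨a₀, e, -⟩ | ⟨f, g, -, -, -, e, -⟩ |
    ⟨y, z, e, e', -⟩ | ⟨y, z, e, e', -⟩ | ⟨n, e, e', -⟩ | ⟨x, y, n, e, e', -⟩ |
    ⟨x, y, m, n, e, e', -⟩
  · exact .app (ha _ h) (hb _ h')
  · exact (hk ⟨_, e⟩).elim
  · exact (hs ⟨_, _, e⟩).elim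
  · exact (hp ⟨_, _, .inl e, e'⟩).elim
  · exact (hp ⟨_, _, .inr e, e'⟩).elim
  · exact (hN ⟨_, e, e'⟩).elim
  · exact (hd ⟨_, _, _, _, e, e'⟩).elim
  · exact (hd ⟨_, _, _, _, e, e'⟩).elim

/-- Every term has a complete development. -/
theorem Par.triangle (t : ClosedTerm) : ∃ w, ∀ u, Par t u → Par u w := by
  induction t using ClosedTerm.induction with
  | const c => exact ⟨cst c, fun u hu => hu.cst_inv ▸ .refl _⟩
  | app a b ha hb =>
    obtain ⟨a₁, ha⟩ := ha
    obtain ⟨b₁, hb⟩ := hb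
    exact Par.app_triangle ha hb

/-- Reduction in finitely many parallel steps. -/
abbrev Pars : ClosedTerm → ClosedTerm → Prop := Relation.ReflTransGen Par

/-- Church–Rosser: complete developments give the diamond property of `Par`, so having a common
reduct is an equivalence relation, and it contains `Red`. -/
theorem join_of_cls_eq {t u : ClosedTerm} (e : cls t = cls u) : ∃ w, Pars t w ∧ Pars u w := by
  have h : Relation.EqvGen Red t u := Quotient.exact e
  clear e
  have trans : Equivalence (Relation.Join Pars) :=
    Relation.equivalence_join_reflTransGen fun a b c hb hc => by
      obtain ⟨w, hw⟩ := Par.triangle a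
      exact ⟨w, .single (hw _ hb), .single (hw _ hc)⟩
  change Relation.Join Pars t u
  induction h with
  | rel a b h => exact ⟨b, .single (Red.par h), .refl⟩
  | refl a => exact trans.refl a
  | symm a b _ ih => exact trans.symm ih
  | trans a b c _ _ ih ih' => exact trans.trans ih ih'

theorem cls_eq_of_pars {t u : ClosedTerm} (h : Pars t u) : cls t = cls u := by
  have app : ∀ {a a' b b' : ClosedTerm}, cls a = cls a' → cls b = cls b' →
      cls (a ⬝ b) = cls (a' ⬝ b') := fun h h' =>
    Quotient.sound (conv_app (Quotient.exact h) (Quotient.exact h'))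
  have red : ∀ {a b : ClosedTerm}, Red a b → cls a = cls b := fun h =>
    Quotient.sound (.rel _ _ h)
  have par : ∀ {a b : ClosedTerm}, Par a b → cls a = cls b := fun h => by
    induction h with
    | const c => rfl
    | app _ _ ih ih' => exact app ih ih'
    | k b _ ih => exact (red (.k _ _)).trans ih
    | s _ _ _ ih ih' ih'' => exact (red (.s _ _ _)).trans (app (app ih ih'') (app ih' ih''))
    | p0 b _ ih => exact (red (.p0 _ _)).trans ih
    | p1 a _ ih => exact (red (.p1 _ _)).trans ih
    | pN n => exact red (.pN n)
    | dN_eq v n _ ih => exact (red (.dN_eq _ _ _)).trans ih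
    | dN_ne u m n h _ ih => exact (red (.dN_ne _ _ _ _ h)).trans ih
  induction h with
  | refl => rfl
  | tail _ h ih => exact ih.trans (par h)

theorem Pars.cst_inv {c : Const} {x : ClosedTerm} (h : Pars (cst c) x) : x = cst c := by
  induction h with
  | refl => rfl
  | tail _ h ih => subst ih; exact h.cst_inv

theorem Pars.cst_app_inv {c : Const} {a x : ClosedTerm} (hc : InertOne c)
    (h : Pars (cst c ⬝ a) x) : ∃ a', x = cst c ⬝ a' ∧ Pars a a' := by
  induction h with
  | refl => exact ⟨_, rfl, .refl⟩
  | tail _ h ih =>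
    obtain ⟨a', rfl, h'⟩ := ih
    obtain ⟨a'', rfl, h''⟩ := h.cst_app_inv hc
    exact ⟨_, rfl, h'.tail h''⟩

theorem Pars.cst_app₂_inv {c : Const} {a b x : ClosedTerm} (hc : InertTwo c)
    (h : Pars (cst c ⬝ a ⬝ b) x) : ∃ a' b', x = cst c ⬝ a' ⬝ b' ∧ Pars a a' ∧ Pars b b' := by
  induction h with
  | refl => exact ⟨_, _, rfl, .refl, .refl⟩
  | tail _ h ih =>
    obtain ⟨a', b', rfl, ha, hb⟩ := ih
    obtain ⟨a'', b'', rfl, ha', hb'⟩ := h.cst_app₂_inv hc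
    exact ⟨_, _, rfl, ha.tail ha', hb.tail hb'⟩

/-! ## Unique generation in the model -/

theorem cls_surjective (a : MKF) : ∃ t, cls t = a := Quotient.exists_rep a

theorem cls_app (t u : ClosedTerm) : cls (t ⬝ u) = cls t ⬝ cls u := rfl

theorem cls_cst (c : Const) : cls (cst c) = cst c := rfl

theorem MKF.cst_inj {c d : Const} (h : (cst c : MKF) = cst d) : c = d := by
  obtain ⟨w, h1, h2⟩ := join_of_cls_eq (t := cst c) (u := cst d) h
  exact ClosedTerm.cst_inj.1 (h1.cst_inv.symm.trans h2.cst_inv)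

theorem MKF.app_ne_cst {c d : Const} (hc : InertOne c) (a : MKF) : cst c ⬝ a ≠ cst d := by
  obtain ⟨a, rfl⟩ := cls_surjective a
  intro h
  obtain ⟨w, h1, h2⟩ := join_of_cls_eq (t := cst c ⬝ a) (u := cst d) h
  obtain ⟨_, rfl, -⟩ := h1.cst_app_inv hc
  exact ClosedTerm.app_ne_cst h2.cst_inv

/-- A common reduct of both sides keeps the inert heads, so heads can be compared syntactically and
the arguments have a common reduct as well. The neighbouring inequalities rest on the same argument.
-/
theorem MKF.app_inj {c d : Const} (hc : InertOne c) (hd : InertOne d) {a b : MKF}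
    (h : cst c ⬝ a = cst d ⬝ b) : c = d ∧ a = b := by
  obtain ⟨a, rfl⟩ := cls_surjective a
  obtain ⟨b, rfl⟩ := cls_surjective b
  obtain ⟨w, h1, h2⟩ := join_of_cls_eq (t := cst c ⬝ a) (u := cst d ⬝ b) h
  obtain ⟨a', rfl, ha⟩ := h1.cst_app_inv hc
  obtain ⟨b', e, hb⟩ := h2.cst_app_inv hd
  simp only [ClosedTerm.app_inj, ClosedTerm.cst_inj] at e
  obtain ⟨rfl, rfl⟩ := e
  exact ⟨rfl, (cls_eq_of_pars ha).trans (cls_eq_of_pars hb).symm⟩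

theorem MKF.app₂_ne_cst {c d : Const} (hc : InertTwo c) (a b : MKF) : cst c ⬝ a ⬝ b ≠ cst d := by
  obtain ⟨a, rfl⟩ := cls_surjective a
  obtain ⟨b, rfl⟩ := cls_surjective b
  intro h
  obtain ⟨w, h1, h2⟩ := join_of_cls_eq (t := cst c ⬝ a ⬝ b) (u := cst d) h
  obtain ⟨_, _, rfl, -⟩ := h1.cst_app₂_inv hc
  exact ClosedTerm.app_ne_cst h2.cst_inv

theorem MKF.app₂_ne_app {c d : Const} (hc : InertTwo c) (hd : InertOne d) (a b e : MKF) :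
    cst c ⬝ a ⬝ b ≠ cst d ⬝ e := by
  obtain ⟨a, rfl⟩ := cls_surjective a
  obtain ⟨b, rfl⟩ := cls_surjective b
  obtain ⟨e, rfl⟩ := cls_surjective e
  intro h
  obtain ⟨w, h1, h2⟩ := join_of_cls_eq (t := cst c ⬝ a ⬝ b) (u := cst d ⬝ e) h
  obtain ⟨_, _, rfl, -⟩ := h1.cst_app₂_inv hc
  obtain ⟨_, h, -⟩ := h2.cst_app_inv hd
  exact ClosedTerm.app_ne_cst (ClosedTerm.app_inj.1 h).1

theorem MKF.app₂_inj {c : Const} (hc : InertTwo c) {a b a' b' : MKF}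
    (h : cst c ⬝ a ⬝ b = cst c ⬝ a' ⬝ b') : a = a' ∧ b = b' := by
  obtain ⟨a, rfl⟩ := cls_surjective a
  obtain ⟨b, rfl⟩ := cls_surjective b
  obtain ⟨a', rfl⟩ := cls_surjective a'
  obtain ⟨b', rfl⟩ := cls_surjective b'
  obtain ⟨w, h1, h2⟩ := join_of_cls_eq (t := cst c ⬝ a ⬝ b) (u := cst c ⬝ a' ⬝ b') h
  obtain ⟨x, y, rfl, hx, hy⟩ := h1.cst_app₂_inv hc
  obtain ⟨x', y', e, hx', hy'⟩ := h2.cst_app₂_inv hc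
  simp only [ClosedTerm.app_inj, true_and] at e
  obtain ⟨rfl, rfl⟩ := e
  exact ⟨(cls_eq_of_pars hx).trans (cls_eq_of_pars hx').symm,
    (cls_eq_of_pars hy).trans (cls_eq_of_pars hy').symm⟩

theorem Generator.inertOne {c : Const} (h : Generator c) : InertOne c := by
  rcases h with rfl | rfl | rfl | rfl | rfl | rfl | rfl <;> simp [InertOne]

theorem inertTwo_l : InertTwo .l := by simp [InertTwo, InertOne]

theorem MKF.pair_inj {a b a' b' : MKF} (h : pair a b = pair a' b') : a = a' ∧ b = b' :=
  MKF.app₂_inj (c := .p) (by simp [InertTwo, InertOne]) h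

theorem MKF.generator_app_ne {c d : Const} (hc : Generator c) (hd : Generator d) (hcd : c ≠ d)
    (a b : MKF) : cst c ⬝ a ≠ cst d ⬝ b :=
  fun h => hcd (MKF.app_inj hc.inertOne hd.inertOne h).1

theorem MKF.generator_app_inj {c : Const} (hc : Generator c) {a b : MKF} :
    cst c ⬝ a = cst c ⬝ b ↔ a = b :=
  ⟨fun h => (MKF.app_inj hc.inertOne hc.inertOne h).2, fun h => h ▸ rfl⟩

/-! ## Numerals in the model -/

theorem cls_num : ∀ n : ℕ, cls (num n) = num n
  | 0 => rfl
  | n + 1 => by rw [num, cls_app, cls_num n, cls_cst]; rfl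

theorem isN_iff {a : MKF} : IsN a ↔ ∃ n : ℕ, a = num n := by
  constructor
  · rintro ⟨t, rfl, n, h⟩
    refine ⟨n, (cls_eq_of_pars (Relation.ReflTransGen.mono (r := Red) (fun _ _ => Red.par) _ _ h)).trans (cls_num n)⟩
  · rintro ⟨n, rfl⟩
    exact ⟨num n, cls_num n, n, .refl⟩

theorem MKF.num_inj : ∀ {m n : ℕ}, (num m : MKF) = num n → m = n
  | 0, 0, _ => rfl
  | 0, n + 1, h => (MKF.app_ne_cst (by simp [InertOne]) _ h.symm).elim
  | m + 1, 0, h => (MKF.app_ne_cst (by simp [InertOne]) _ h).elim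
  | m + 1, n + 1, h =>
    congrArg _ (num_inj (MKF.app_inj (c := .sN) (d := .sN) (by simp [InertOne])
      (by simp [InertOne]) h).2)

/-! ## Decomposition of elements built by the generators -/

@[simp] theorem generator_eqC : Generator .eqC := by simp [Generator]

@[simp] theorem generator_negC : Generator .negC := by simp [Generator]

@[simp] theorem generator_andC : Generator .andC := by simp [Generator]

@[simp] theorem generator_impC : Generator .impC := by simp [Generator]

@[simp] theorem generator_allC : Generator .allC := by simp [Generator]

@[simp] theorem generator_natC : Generator .natC := by simp [Generator]

@[simp] theorem generator_l : Generator .l := by simp [Generator]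

theorem MKF.generator_eq {c d : Const} (hc : Generator c) (hd : Generator d) {a b : MKF} :
    cst c ⬝ a = cst d ⬝ b ↔ c = d ∧ a = b :=
  ⟨MKF.app_inj hc.inertOne hd.inertOne, fun ⟨h, h'⟩ => h ▸ h' ▸ rfl⟩

theorem MKF.pair_eq {a b a' b' : MKF} : pair a b = pair a' b' ↔ a = a' ∧ b = b' :=
  ⟨MKF.pair_inj, fun ⟨h, h'⟩ => h ▸ h' ▸ rfl⟩

theorem MKF.lim_app_eq {a b a' b' : MKF} :
    cst .l ⬝ a ⬝ b = cst .l ⬝ a' ⬝ b' ↔ a = a' ∧ b = b' :=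
  ⟨MKF.app₂_inj inertTwo_l, fun ⟨h, h'⟩ => h ▸ h' ▸ rfl⟩

theorem MKF.lim_app_eq_generator {d : Const} (hd : Generator d) {a b e : MKF} :
    cst .l ⬝ a ⬝ b = cst d ⬝ e ↔ False :=
  iff_false_intro (MKF.app₂_ne_app inertTwo_l hd.inertOne a b e)

theorem MKF.generator_eq_lim_app {d : Const} (hd : Generator d) {a b e : MKF} :
    cst d ⬝ e = cst .l ⬝ a ⬝ b ↔ False :=
  iff_false_intro (MKF.app₂_ne_app inertTwo_l hd.inertOne a b e).symm

/-! ### The clauses of `Phi` at elements of known shape -/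

section Shapes

set_option linter.unusedSimpArgs false

variable {X Y : Set MKF} {α : Ordinal.{0}} {b c d : MKF}

theorem dNeg_inj : dNeg b = dNeg c ↔ b = c := MKF.generator_app_inj (by simp)

theorem dEq_ne_dNeg : dEq b c ≠ dNeg d := MKF.generator_app_ne (by simp) (by simp) (by simp) _ _

theorem dNat_ne_dNeg : dNat b ≠ dNeg c := MKF.generator_app_ne (by simp) (by simp) (by simp) _ _

theorem dAnd_ne_dNeg : dAnd b c ≠ dNeg d := MKF.generator_app_ne (by simp) (by simp) (by simp) _ _

theorem dImp_ne_dNeg : dImp b c ≠ dNeg d := MKF.generator_app_ne (by simp) (by simp) (by simp) _ _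

theorem dAll_ne_dNeg : dAll b ≠ dNeg c := MKF.generator_app_ne (by simp) (by simp) (by simp) _ _

theorem lim_app_ne_dNeg : lim b ⬝ c ≠ dNeg d :=
  MKF.app₂_ne_app inertTwo_l (Generator.inertOne (by simp)) _ _ _

/-- The assumption on Y removes the first clause of `Phi`, and unique generation removes every other
clause whose shape does not match. The lemmas for the remaining shapes have the same proof. -/
theorem phi_dEq (hY : dEq b c ∉ Y) :
    Phi X Y (dEq b c) α ↔ α = 0 ∧ b = c := by
  simp only [Phi, hY, false_or, not_false_eq_true, true_and]
  simp [dEq, dNeg, dAnd, dImp, dAll, dNat, lim, MKF.generator_eq, MKF.pair_eq,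
    MKF.lim_app_eq, MKF.lim_app_eq_generator, MKF.generator_eq_lim_app] at hY ⊢
  exact fun _ => eq_comm

theorem phi_not_dEq (hY : dNeg (dEq b c) ∉ Y) :
    Phi X Y (dNeg (dEq b c)) α ↔ α = 0 ∧ b ≠ c := by
  simp only [Phi, hY, false_or, not_false_eq_true, true_and]
  simp [dEq, dNeg, dAnd, dImp, dAll, dNat, lim, MKF.generator_eq, MKF.pair_eq,
    MKF.lim_app_eq, MKF.lim_app_eq_generator, MKF.generator_eq_lim_app] at hY ⊢

theorem phi_dNat (hY : dNat b ∉ Y) :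
    Phi X Y (dNat b) α ↔ α = 0 ∧ IsN b := by
  simp only [Phi, hY, false_or, not_false_eq_true, true_and]
  simp [dEq, dNeg, dAnd, dImp, dAll, dNat, lim, MKF.generator_eq, MKF.pair_eq,
    MKF.lim_app_eq, MKF.lim_app_eq_generator, MKF.generator_eq_lim_app] at hY ⊢

theorem phi_not_dNat (hY : dNeg (dNat b) ∉ Y) :
    Phi X Y (dNeg (dNat b)) α ↔ α = 0 ∧ ¬ IsN b := by
  simp only [Phi, hY, false_or, not_false_eq_true, true_and]
  simp [dEq, dNeg, dAnd, dImp, dAll, dNat, lim, MKF.generator_eq, MKF.pair_eq,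
    MKF.lim_app_eq, MKF.lim_app_eq_generator, MKF.generator_eq_lim_app] at hY ⊢

theorem phi_not_not (hY : dNeg (dNeg b) ∉ Y) :
    Phi X Y (dNeg (dNeg b)) α ↔ b ∈ X := by
  simp only [Phi, hY, false_or, not_false_eq_true, true_and]
  simp [dEq, dNeg, dAnd, dImp, dAll, dNat, lim, MKF.generator_eq, MKF.pair_eq,
    MKF.lim_app_eq, MKF.lim_app_eq_generator, MKF.generator_eq_lim_app] at hY ⊢

theorem phi_dAnd (hY : dAnd b c ∉ Y) :
    Phi X Y (dAnd b c) α ↔ b ∈ X ∧ c ∈ X := by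
  simp only [Phi, hY, false_or, not_false_eq_true, true_and]
  simp [dEq, dNeg, dAnd, dImp, dAll, dNat, lim, MKF.generator_eq, MKF.pair_eq,
    MKF.lim_app_eq, MKF.lim_app_eq_generator, MKF.generator_eq_lim_app] at hY ⊢

theorem phi_not_dAnd (hY : dNeg (dAnd b c) ∉ Y) :
    Phi X Y (dNeg (dAnd b c)) α ↔ dNeg b ∈ X ∨ dNeg c ∈ X := by
  simp only [Phi, hY, false_or, not_false_eq_true, true_and]
  simp [dEq, dNeg, dAnd, dImp, dAll, dNat, lim, MKF.generator_eq, MKF.pair_eq,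
    MKF.lim_app_eq, MKF.lim_app_eq_generator, MKF.generator_eq_lim_app] at hY ⊢

theorem phi_dImp (hY : dImp b c ∉ Y) :
    Phi X Y (dImp b c) α ↔ dNeg b ∈ X ∨ c ∈ X := by
  simp only [Phi, hY, false_or, not_false_eq_true, true_and]
  simp [dEq, dNeg, dAnd, dImp, dAll, dNat, lim, MKF.generator_eq, MKF.pair_eq,
    MKF.lim_app_eq, MKF.lim_app_eq_generator, MKF.generator_eq_lim_app] at hY ⊢

theorem phi_not_dImp (hY : dNeg (dImp b c) ∉ Y) :
    Phi X Y (dNeg (dImp b c)) α ↔ b ∈ X ∧ dNeg c ∈ X := by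
  simp only [Phi, hY, false_or, not_false_eq_true, true_and]
  simp [dEq, dNeg, dAnd, dImp, dAll, dNat, lim, MKF.generator_eq, MKF.pair_eq,
    MKF.lim_app_eq, MKF.lim_app_eq_generator, MKF.generator_eq_lim_app] at hY ⊢

theorem phi_dAll (hY : dAll b ∉ Y) :
    Phi X Y (dAll b) α ↔ ∀ x, b ⬝ x ∈ X := by
  simp only [Phi, hY, false_or, not_false_eq_true, true_and]
  simp [dEq, dNeg, dAnd, dImp, dAll, dNat, lim, MKF.generator_eq, MKF.pair_eq,
    MKF.lim_app_eq, MKF.lim_app_eq_generator, MKF.generator_eq_lim_app] at hY ⊢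

theorem phi_not_dAll (hY : dNeg (dAll b) ∉ Y) :
    Phi X Y (dNeg (dAll b)) α ↔ ∃ x, dNeg (b ⬝ x) ∈ X := by
  simp only [Phi, hY, false_or, not_false_eq_true, true_and]
  simp [dEq, dNeg, dAnd, dImp, dAll, dNat, lim, MKF.generator_eq, MKF.pair_eq,
    MKF.lim_app_eq, MKF.lim_app_eq_generator, MKF.generator_eq_lim_app] at hY ⊢

theorem phi_lim (hY : lim b ⬝ c ∉ Y) :
    Phi X Y (lim b ⬝ c) α ↔ IsSuc α ∧ dNeg (lim b ⬝ c) ∉ Y ∧ ClassIn Y b ∧ c ∈ Y := by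
  simp only [Phi, hY, false_or, not_false_eq_true, true_and]
  simp [dEq, dNeg, dAnd, dImp, dAll, dNat, lim, MKF.generator_eq, MKF.pair_eq,
    MKF.lim_app_eq, MKF.lim_app_eq_generator, MKF.generator_eq_lim_app] at hY ⊢

theorem phi_not_lim (hY : dNeg (lim b ⬝ c) ∉ Y) :
    Phi X Y (dNeg (lim b ⬝ c)) α ↔ IsSuc α ∧ dNeg (dNeg (lim b ⬝ c)) ∉ Y ∧ ClassIn Y b ∧ c ∉ Y := by
  simp only [Phi, hY, false_or, not_false_eq_true, true_and]
  simp [dEq, dNeg, dAnd, dImp, dAll, dNat, lim, MKF.generator_eq, MKF.pair_eq,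
    MKF.lim_app_eq, MKF.lim_app_eq_generator, MKF.generator_eq_lim_app] at hY ⊢

end Shapes

/-! ## Stages -/

/-- What is true before stage `α`. -/
def Zlt (α : Ordinal.{0}) : Set MKF := {a | ∃ β < α, a ∈ Z β}

theorem Zlt_succ (α : Ordinal.{0}) : Zlt (α + 1) = Z α :=
  Set.Subset.antisymm (fun _ ⟨_, h, ha⟩ => Z_mono (Order.lt_add_one_iff.1 h) ha)
    fun _ ha => ⟨α, Order.lt_add_one_iff.2 le_rfl, ha⟩

/-- `Zlt` is empty at 0, the preceding stage at a successor and the union at a limit, so one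
equation replaces the three cases of the recursion. -/
theorem Z_eq_lfp (α : Ordinal.{0}) : Z α = OrderHom.lfp (PhiHom (Zlt α) α) := by
  rcases Ordinal.zero_or_succ_or_isSuccLimit α with rfl | ⟨β, rfl⟩ | h
  · rw [Z_zero]
    congr
    ext a
    simp [Zlt]
  · rw [Order.succ_eq_add_one, Z_succ, Zlt_succ]
  · rw [Z_limit h]
    congr
    ext a
    simp [Zlt]

theorem mem_Z_iff {α : Ordinal.{0}} {a : MKF} : a ∈ Z α ↔ Phi (Z α) (Zlt α) a α := by
  conv_lhs => rw [Z_eq_lfp, ← OrderHom.map_lfp, ← Z_eq_lfp]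
  rfl

theorem Zlt_subset (α : Ordinal.{0}) : Zlt α ⊆ Z α := fun _ ⟨_, h, ha⟩ => Z_mono h.le ha

/-- Induction on the least fixed point, strengthened so that constituents are known to lie in `Z α`
as well as in S. -/
theorem Z_induction {α : Ordinal.{0}} {S : Set MKF}
    (h : ∀ a, Phi (Z α ∩ S) (Zlt α) a α → a ∈ S) : Z α ⊆ S := by
  have : OrderHom.lfp (PhiHom (Zlt α) α) ≤ Z α ∩ S := OrderHom.lfp_le _ fun a ha =>
    ⟨mem_Z_iff.2 (Phi_mono Set.inter_subset_left ha), h a ha⟩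
  rw [Z_eq_lfp]
  exact this.trans Set.inter_subset_right

/-- At the first stage an element is not yet in `Zlt β`, which is what the shape lemmas for `Phi`
require. -/
theorem exists_first_stage {α : Ordinal.{0}} {a : MKF} (h : a ∈ Z α) :
    ∃ β ≤ α, a ∈ Z β ∧ a ∉ Zlt β := by
  induction α using WellFoundedLT.induction with
  | ind α ih =>
    by_cases h' : a ∈ Zlt α
    · obtain ⟨β, hβ, ha⟩ := h'
      obtain ⟨γ, hγ, hγ'⟩ := ih β hβ ha
      exact ⟨γ, hγ.trans hβ.le, hγ'⟩
    · exact ⟨α, le_rfl, h, h'⟩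

/-! ### Truth clauses at every stage -/

section TruthAxioms

variable {α : Ordinal.{0}} {b c : MKF}

/-- Whatever enters at stage `β` by the operator belongs to `Z β`. -/
theorem mem_Z_of_phi {a : MKF} (h : a ∉ Zlt α → Phi (Z α) (Zlt α) a α) : a ∈ Z α := by
  by_cases h' : a ∈ Zlt α
  · exact Zlt_subset α h'
  · exact mem_Z_iff.2 (h h')

/-- Atomic elements can enter only at stage 0, so their truth does not depend on the stage. -/
theorem dEq_mem : dEq b c ∈ Z α ↔ b = c := by
  constructor
  · intro h
    obtain ⟨β, -, h, h'⟩ := exists_first_stage h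
    exact ((phi_dEq h').1 (mem_Z_iff.1 h)).2
  · intro h
    exact Z_mono (zero_le : 0 ≤ α) (mem_Z_of_phi fun h' => (phi_dEq h').2 ⟨rfl, h⟩)

theorem not_dEq_mem : dNeg (dEq b c) ∈ Z α ↔ b ≠ c := by
  constructor
  · intro h
    obtain ⟨β, -, h, h'⟩ := exists_first_stage h
    exact ((phi_not_dEq h').1 (mem_Z_iff.1 h)).2
  · intro h
    exact Z_mono (zero_le : 0 ≤ α) (mem_Z_of_phi fun h' => (phi_not_dEq h').2 ⟨rfl, h⟩)

theorem dNat_mem : dNat b ∈ Z α ↔ IsN b := by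
  constructor
  · intro h
    obtain ⟨β, -, h, h'⟩ := exists_first_stage h
    exact ((phi_dNat h').1 (mem_Z_iff.1 h)).2
  · intro h
    exact Z_mono (zero_le : 0 ≤ α) (mem_Z_of_phi fun h' => (phi_dNat h').2 ⟨rfl, h⟩)

theorem not_dNat_mem : dNeg (dNat b) ∈ Z α ↔ ¬ IsN b := by
  constructor
  · intro h
    obtain ⟨β, -, h, h'⟩ := exists_first_stage h
    exact ((phi_not_dNat h').1 (mem_Z_iff.1 h)).2
  · intro h
    exact Z_mono (zero_le : 0 ≤ α) (mem_Z_of_phi fun h' => (phi_not_dNat h').2 ⟨rfl, h⟩)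

/-- Forward, the constituent is true at the first stage of the compound and persists; backward, the
compound is already true before α or its clause applies at α. All compound shapes follow this
pattern. -/
theorem not_not_mem : dNeg (dNeg b) ∈ Z α ↔ b ∈ Z α := by
  constructor
  · intro h
    obtain ⟨β, hβ, h, h'⟩ := exists_first_stage h
    exact Z_mono hβ ((phi_not_not h').1 (mem_Z_iff.1 h))
  · exact fun h => mem_Z_of_phi fun h' => (phi_not_not h').2 h

theorem dAnd_mem : dAnd b c ∈ Z α ↔ b ∈ Z α ∧ c ∈ Z α := by
  constructor
  · intro h
    obtain ⟨β, hβ, h, h'⟩ := exists_first_stage h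
    exact ((phi_dAnd h').1 (mem_Z_iff.1 h)).imp (Z_mono hβ ·) (Z_mono hβ ·)
  · exact fun h => mem_Z_of_phi fun h' => (phi_dAnd h').2 h

theorem not_dAnd_mem : dNeg (dAnd b c) ∈ Z α ↔ dNeg b ∈ Z α ∨ dNeg c ∈ Z α := by
  constructor
  · intro h
    obtain ⟨β, hβ, h, h'⟩ := exists_first_stage h
    exact ((phi_not_dAnd h').1 (mem_Z_iff.1 h)).imp (Z_mono hβ ·) (Z_mono hβ ·)
  · exact fun h => mem_Z_of_phi fun h' => (phi_not_dAnd h').2 h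

theorem dImp_mem : dImp b c ∈ Z α ↔ dNeg b ∈ Z α ∨ c ∈ Z α := by
  constructor
  · intro h
    obtain ⟨β, hβ, h, h'⟩ := exists_first_stage h
    exact ((phi_dImp h').1 (mem_Z_iff.1 h)).imp (Z_mono hβ ·) (Z_mono hβ ·)
  · exact fun h => mem_Z_of_phi fun h' => (phi_dImp h').2 h

theorem not_dImp_mem : dNeg (dImp b c) ∈ Z α ↔ b ∈ Z α ∧ dNeg c ∈ Z α := by
  constructor
  · intro h
    obtain ⟨β, hβ, h, h'⟩ := exists_first_stage h
    exact ((phi_not_dImp h').1 (mem_Z_iff.1 h)).imp (Z_mono hβ ·) (Z_mono hβ ·)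
  · exact fun h => mem_Z_of_phi fun h' => (phi_not_dImp h').2 h

theorem dAll_mem : dAll b ∈ Z α ↔ ∀ x, b ⬝ x ∈ Z α := by
  constructor
  · intro h
    obtain ⟨β, hβ, h, h'⟩ := exists_first_stage h
    exact fun x => Z_mono hβ ((phi_dAll h').1 (mem_Z_iff.1 h) x)
  · exact fun h => mem_Z_of_phi fun h' => (phi_dAll h').2 h

theorem not_dAll_mem : dNeg (dAll b) ∈ Z α ↔ ∃ x, dNeg (b ⬝ x) ∈ Z α := by
  constructor
  · intro h
    obtain ⟨β, hβ, h, h'⟩ := exists_first_stage h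
    exact ((phi_not_dAll h').1 (mem_Z_iff.1 h)).imp fun _ => (Z_mono hβ ·)
  · exact fun h => mem_Z_of_phi fun h' => (phi_not_dAll h').2 h

/-- An application of a limit is decided at one stage only. -/
theorem exists_stage_of_lim_mem (h : lim b ⬝ c ∈ Z α) : ∃ β, β + 1 ≤ α ∧ ClassIn (Z β) b ∧
    c ∈ Z β ∧ lim b ⬝ c ∈ Z (β + 1) ∧ lim b ⬝ c ∉ Z β ∧ dNeg (lim b ⬝ c) ∉ Z β := by
  obtain ⟨β, hβ, h, h'⟩ := exists_first_stage h
  obtain ⟨⟨γ, rfl⟩, hn, hc, hm⟩ := (phi_lim h').1 (mem_Z_iff.1 h)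
  rw [Zlt_succ] at h' hn hc hm
  exact ⟨γ, hβ, hc, hm, h, h', hn⟩

theorem exists_stage_of_not_lim_mem (h : dNeg (lim b ⬝ c) ∈ Z α) : ∃ β, β + 1 ≤ α ∧
    ClassIn (Z β) b ∧ c ∉ Z β ∧ dNeg (lim b ⬝ c) ∈ Z (β + 1) ∧ lim b ⬝ c ∉ Z β ∧
    dNeg (lim b ⬝ c) ∉ Z β := by
  obtain ⟨β, hβ, h, h'⟩ := exists_first_stage h
  obtain ⟨⟨γ, rfl⟩, hn, hc, hm⟩ := (phi_not_lim h').1 (mem_Z_iff.1 h)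
  rw [Zlt_succ] at h' hn hc hm
  -- For a negated limit application the side condition of `Phi` speaks of its double negation,
  -- which is true exactly when the application itself is.
  exact ⟨γ, hβ, hc, hm, h, fun h => hn (not_not_mem.2 h), h'⟩

/-- Suppose the two entered at β + 1 and γ + 1. If β ≠ γ, the earlier decision blocks the later one;
if β = γ, then c would be both in and outside `Z β`. -/
theorem lim_mem_elim (h : lim b ⬝ c ∈ Z α) : dNeg (lim b ⬝ c) ∉ Z α := by
  intro hn
  obtain ⟨β, -, -, hm, h, h', h''⟩ := exists_stage_of_lim_mem h
  obtain ⟨γ, -, -, hm', hn, hn', hn''⟩ := exists_stage_of_not_lim_mem hn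
  rcases lt_trichotomy β γ with hlt | rfl | hlt
  · exact hn' (Z_mono (Order.add_one_le_of_lt hlt) h)
  · exact hm' hm
  · exact h'' (Z_mono (Order.add_one_le_of_lt hlt) hn)

end TruthAxioms

/-! ## Consistency -/

/-- Induction inside stage α against the fixed set `Z β`, using the truth clauses of `Z β` to take a
contradicting compound apart. The second conjunct is needed because negative clauses have
constituents of the form `dNeg b`. -/
theorem consistent_of_consistent_before {α β : Ordinal.{0}} (hβ : β ≤ α)
    (h : ∀ a ∈ Zlt α, dNeg a ∉ Z β ∧ ∀ b, a = dNeg b → b ∉ Z β) :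
    ∀ a ∈ Z α, dNeg a ∉ Z β ∧ ∀ b, a = dNeg b → b ∉ Z β := by
  have neg : ∀ {a}, a ∉ Z β → dNeg (dNeg a) ∉ Z β ∧ ∀ b, dNeg a = dNeg b → b ∉ Z β :=
    fun ha => ⟨fun h => ha (not_not_mem.1 h), fun b e => dNeg_inj.1 e ▸ ha⟩
  refine Z_induction (S := {a | dNeg a ∉ Z β ∧ ∀ b, a = dNeg b → b ∉ Z β}) fun a ha => ?_
  rcases id ha with ha' | ⟨b, c, -, rfl, hbc⟩ | ⟨b, c, -, rfl, hbc⟩ | ⟨b, -, rfl, hb⟩ |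
    ⟨b, -, rfl, hb⟩ | ⟨b, rfl, -, hb⟩ | ⟨b, c, rfl, -, hb, hc⟩ | ⟨b, c, rfl, -, hbc⟩ |
    ⟨b, c, rfl, -, hbc⟩ | ⟨b, c, rfl, -, hb, hc⟩ | ⟨f, rfl, -, hf⟩ | ⟨f, rfl, -, x, hx⟩ |
    ⟨b, c, -, rfl, -⟩ | ⟨b, c, -, rfl, -⟩
  · exact h a ha'
  · exact ⟨fun h => not_dEq_mem.1 h hbc, fun _ e => (dEq_ne_dNeg e).elim⟩
  · exact neg fun h => hbc (dEq_mem.1 h)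
  · exact ⟨fun h => not_dNat_mem.1 h hb, fun _ e => (dNat_ne_dNeg e).elim⟩
  · exact neg fun h => hb (dNat_mem.1 h)
  · exact neg hb.2.1
  · exact ⟨fun h => (not_dAnd_mem.1 h).elim hb.2.1 hc.2.1, fun _ e => (dAnd_ne_dNeg e).elim⟩
  · refine neg fun h => ?_
    have h := dAnd_mem.1 h
    exact hbc.elim (fun hb => hb.2.2 _ rfl h.1) fun hc => hc.2.2 _ rfl h.2
  · refine ⟨fun h => ?_, fun _ e => (dImp_ne_dNeg e).elim⟩
    have h := not_dImp_mem.1 h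
    exact hbc.elim (fun hb => hb.2.2 _ rfl h.1) fun hc => hc.2.1 h.2
  · exact neg fun h => (dImp_mem.1 h).elim hb.2.1 (hc.2.2 _ rfl)
  · refine ⟨fun h => ?_, fun _ e => (dAll_ne_dNeg e).elim⟩
    obtain ⟨x, hx⟩ := not_dAll_mem.1 h
    exact (hf x).2.1 hx
  · exact neg fun h => hx.2.2 _ rfl (dAll_mem.1 h x)
  · have ha := mem_Z_iff.2 (Phi_mono Set.inter_subset_left ha)
    exact ⟨fun h => lim_mem_elim ha (Z_mono hβ h), fun _ e => (lim_app_ne_dNeg e).elim⟩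
  · have ha := mem_Z_iff.2 (Phi_mono Set.inter_subset_left ha)
    exact neg fun h => lim_mem_elim (Z_mono hβ h) ha

/-- Two passes are needed: the induction hypothesis compares only stages below α with one another,
whereas taking β = α in `consistent_of_consistent_before` presupposes a comparison of the earlier
stages with `Z α`. -/
theorem Z_consistent {α : Ordinal.{0}} {a : MKF} (ha : a ∈ Z α) : dNeg a ∉ Z α := by
  induction α using WellFoundedLT.induction generalizing a with
  | ind α ih =>
    -- First pass: α against each earlier β. Two earlier stages are compared inside their maximum,
    -- which is still below α.
    have before : ∀ β < α, ∀ a ∈ Z α, dNeg a ∉ Z β ∧ ∀ b, a = dNeg b → b ∉ Z β := by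
      intro β hβ
      refine consistent_of_consistent_before hβ.le fun a ⟨γ, hγ, ha⟩ => ?_
      have hm := max_lt hβ hγ
      have ha := Z_mono (le_max_right β γ) ha
      refine ⟨fun h => ih _ hm ha (Z_mono (le_max_left β γ) h), fun b e hb => ?_⟩
      exact ih _ hm (Z_mono (le_max_left β γ) hb) (e ▸ ha)
    -- Second pass: α against itself. Its premise is the first pass read in the opposite direction,
    -- the two conjuncts changing roles.
    refine (consistent_of_consistent_before le_rfl (fun a ⟨γ, hγ, ha⟩ => ?_) a ha).1
    exact ⟨fun h => (before γ hγ _ h).2 _ rfl ha, fun b e hb => (before γ hγ b hb).1 (e ▸ ha)⟩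

/-! ## Universes -/

theorem Z_iota_succ : Z (iota + 1) = Z iota := iota_isLeast.1.symm

/-- The universe `lim f` consists of what is true at the first stage at which `f` is a class. -/
theorem exists_stage_of_class {f : MKF} (hf : ClassIn (Z iota) f) : ∃ β ≤ iota, ClassIn (Z β) f ∧
    ∀ c, (lim f ⬝ c ∈ Z iota ↔ c ∈ Z β) ∧ (dNeg (lim f ⬝ c) ∈ Z iota ↔ c ∉ Z β) := by
  obtain ⟨β, hβ, hmin⟩ := WellFounded.has_min (wellFounded_lt (α := Ordinal.{0}))
    {β | ClassIn (Z β) f} ⟨iota, hf⟩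
  have hle : β ≤ iota := not_lt.1 (hmin iota hf)
  -- The least β may be `iota` itself; this is where stabilisation of the stages is used.
  have hsub : Z (β + 1) ⊆ Z iota := Z_iota_succ ▸ Z_mono (add_le_add_left hle 1)
  -- A decision by stage β would require f to be a class before β, against minimality; hence the
  -- side conditions of `Phi` hold at β + 1.
  have h1 : ∀ c, lim f ⬝ c ∉ Z β := fun c h => by
    obtain ⟨γ, hγ, hc, -⟩ := exists_stage_of_lim_mem h
    exact hmin γ hc (Order.add_one_le_iff.1 hγ)
  have h2 : ∀ c, dNeg (lim f ⬝ c) ∉ Z β := fun c h => by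
    obtain ⟨γ, hγ, hc, -⟩ := exists_stage_of_not_lim_mem h
    exact hmin γ hc (Order.add_one_le_iff.1 hγ)
  have h3 : ∀ c ∈ Z β, lim f ⬝ c ∈ Z iota := fun c hc => hsub <| mem_Z_of_phi fun h => by
    rw [phi_lim h, Zlt_succ]
    exact ⟨⟨β, rfl⟩, h2 c, hβ, hc⟩
  have h4 : ∀ c ∉ Z β, dNeg (lim f ⬝ c) ∈ Z iota := fun c hc => hsub <| mem_Z_of_phi fun h => by
    rw [phi_not_lim h, Zlt_succ]
    exact ⟨⟨β, rfl⟩, fun h => h1 c (not_not_mem.1 h), hβ, hc⟩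
  refine ⟨β, hle, hβ, fun c => ⟨⟨fun h => ?_, h3 c⟩, fun h hc => Z_consistent (h3 c hc) h, h4 c⟩⟩
  by_contra hc
  exact Z_consistent h (h4 c hc)

theorem IsU.exists_stage {u : MKF} (hu : IsU u) : ∃ β ≤ iota,
    ∀ c, (IsT (u ⬝ c) ↔ c ∈ Z β) ∧ (IsT (dNeg (u ⬝ c)) ↔ c ∉ Z β) := by
  obtain ⟨f, rfl, hf⟩ := hu
  obtain ⟨β, hβ, -, h⟩ := exists_stage_of_class hf
  exact ⟨β, hβ, h⟩

/-- At the stage β described by `lim f`, each `f ⬝ x` is already decided, and by consistency the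
decision is the final one. -/
theorem lim_reflects {f : MKF} (hf : ClassIn (Z iota) f) (x : MKF) :
    (IsT (f ⬝ x) → IsT (lim f ⬝ (f ⬝ x))) ∧
      (IsT (dNeg (f ⬝ x)) → IsT (lim f ⬝ dNeg (f ⬝ x))) := by
  obtain ⟨β, hβ, hc, h⟩ := exists_stage_of_class hf
  refine ⟨fun hx => (h _).1.2 ?_, fun hx => (h _).1.2 ?_⟩
  · exact (hc x).resolve_right fun hn => Z_consistent hx (Z_mono hβ hn)
  · exact (hc x).resolve_left fun hn => Z_consistent (Z_mono hβ hn) hx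

/-! ## Proposition induction -/

/-- `𝒜(B, x)` in the model. -/
def OpA (B : MKF → Prop) (x : MKF) : Prop :=
  (∃ y z, x = dEq y z) ∨
  (∃ y, x = dNat y) ∨
  (∃ y, x = dNeg y ∧ B y) ∨
  (∃ y z, x = dAnd y z ∧ ((B y ∧ B z) ∨ (B y ∧ IsT (dNeg y)) ∨ (B z ∧ IsT (dNeg z)))) ∨
  (∃ y z, x = dImp y z ∧ ((B y ∧ B z) ∨ (B y ∧ IsT (dNeg y)) ∨ (B z ∧ IsT z))) ∨
  (∃ g, x = dAll g ∧ ((∀ y, B (g ⬝ y)) ∨ ∃ y, B (g ⬝ y) ∧ IsT (dNeg (g ⬝ y)))) ∨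
  (∃ f y, x = lim f ⬝ y ∧ ∀ z, B (f ⬝ z))

/-- A proposition is either true or has a true negation, so B is proved simultaneously for the true
elements and for those whose negation is true. Outer induction on the stage serves the limit clause,
inner induction on the fixed point the others. -/
theorem prop_induction_stage {B : MKF → Prop} (hB : ∀ x, OpA B x → B x) {α : Ordinal.{0}}
    (hα : α ≤ iota) : ∀ a ∈ Z α, B a ∧ ∀ b, a = dNeg b → B b := by
  have hT : ∀ {a}, a ∈ Z α → IsT a := fun h => Z_mono hα h
  have neg : ∀ {a}, B a → B (dNeg a) ∧ ∀ b, dNeg a = dNeg b → B b := fun ha =>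
    ⟨hB _ (.inr (.inr (.inl ⟨_, rfl, ha⟩))), fun b e => dNeg_inj.1 e ▸ ha⟩
  have eq : ∀ b c, B (dEq b c) := fun b c => hB _ (.inl ⟨b, c, rfl⟩)
  have nat : ∀ b, B (dNat b) := fun b => hB _ (.inr (.inl ⟨b, rfl⟩))
  have and : ∀ {b c}, (B b ∧ B c) ∨ (B b ∧ IsT (dNeg b)) ∨ (B c ∧ IsT (dNeg c)) →
      B (dAnd b c) := fun h => hB _ (.inr (.inr (.inr (.inl ⟨_, _, rfl, h⟩))))
  have imp : ∀ {b c}, (B b ∧ B c) ∨ (B b ∧ IsT (dNeg b)) ∨ (B c ∧ IsT c) →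
      B (dImp b c) := fun h => hB _ (.inr (.inr (.inr (.inr (.inl ⟨_, _, rfl, h⟩)))))
  have all : ∀ {f}, ((∀ y, B (f ⬝ y)) ∨ ∃ y, B (f ⬝ y) ∧ IsT (dNeg (f ⬝ y))) → B (dAll f) :=
    fun h => hB _ (.inr (.inr (.inr (.inr (.inr (.inl ⟨_, rfl, h⟩))))))
  induction α using WellFoundedLT.induction with
  | ind α ih =>
    have before : ∀ a ∈ Zlt α, B a ∧ ∀ b, a = dNeg b → B b := fun a ⟨β, hβ, ha⟩ =>
      ih β hβ (hβ.le.trans hα) (fun h => Z_mono (hβ.le.trans hα) h) a ha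
    -- The values of f are decided before α, though they are not constituents in the fixed point of
    -- stage α.
    have lim : ∀ {f y}, ClassIn (Zlt α) f → B (lim f ⬝ y) := fun {f y} h =>
      hB _ (.inr (.inr (.inr (.inr (.inr (.inr ⟨f, y, rfl, fun z =>
        (h z).elim (fun h => (before _ h).1) fun h => (before _ h).2 _ rfl⟩))))))
    refine Z_induction (S := {a | B a ∧ ∀ b, a = dNeg b → B b}) fun a ha => ?_
    rcases ha with ha | ⟨b, c, -, rfl, -⟩ | ⟨b, c, -, rfl, -⟩ | ⟨b, -, rfl, -⟩ |
      ⟨b, -, rfl, -⟩ | ⟨b, rfl, -, hb⟩ | ⟨b, c, rfl, -, hb, hc⟩ | ⟨b, c, rfl, -, hbc⟩ |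
      ⟨b, c, rfl, -, hbc⟩ | ⟨b, c, rfl, -, hb, hc⟩ | ⟨f, rfl, -, hf⟩ | ⟨f, rfl, -, x, hx⟩ |
      ⟨b, c, -, rfl, -, -, hb, -⟩ | ⟨b, c, -, rfl, -, -, hb, -⟩
    · exact before a ha
    · exact ⟨eq b c, fun _ e => (dEq_ne_dNeg e).elim⟩
    · exact neg (eq b c)
    · exact ⟨nat b, fun _ e => (dNat_ne_dNeg e).elim⟩
    · exact neg (nat b)
    · exact neg (neg hb.2.1).1
    · exact ⟨and (.inl ⟨hb.2.1, hc.2.1⟩), fun _ e => (dAnd_ne_dNeg e).elim⟩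
    -- Only one conjunct need be decided; its falsity gives the second or third alternative of 𝒜.
    · refine neg (and (.inr (hbc.imp (fun h => ?_) fun h => ?_)))
      · exact ⟨h.2.2 _ rfl, hT h.1⟩
      · exact ⟨h.2.2 _ rfl, hT h.1⟩
    · refine ⟨imp (.inr (hbc.imp (fun h => ?_) fun h => ?_)), fun _ e => (dImp_ne_dNeg e).elim⟩
      · exact ⟨h.2.2 _ rfl, hT h.1⟩
      · exact ⟨h.2.1, hT h.1⟩
    · exact neg (imp (.inl ⟨hb.2.1, hc.2.2 _ rfl⟩))
    · exact ⟨all (.inl fun y => (hf y).2.1), fun _ e => (dAll_ne_dNeg e).elim⟩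
    · exact neg (all (.inr ⟨x, hx.2.2 _ rfl, hT hx.1⟩))
    · exact ⟨lim hb, fun _ e => (lim_app_ne_dNeg e).elim⟩
    · exact neg (lim hb)

theorem prop_induction {B : MKF → Prop} (hB : ∀ x, OpA B x → B x) {x : MKF}
    (hx : IsT x ∨ IsT (dNeg x)) : B x :=
  hx.elim (fun h => (prop_induction_stage hB le_rfl x h).1)
    fun h => (prop_induction_stage hB le_rfl _ h).2 x rfl

/-! ## Semantics of terms and formulas -/

section Semantics

variable {β : Type} (e : β → MKF)

theorem realize_app (s t : LFS.Term β) : (s ⬝ t).realize e = s.realize e ⬝ t.realize e := rfl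

theorem realize_cst (c : Const) : (cst c : LFS.Term β).realize e = cst c := rfl

theorem realize_pair (s t : LFS.Term β) :
    (pair s t).realize e = pair (s.realize e) (t.realize e) := rfl

theorem realize_dEq (s t : LFS.Term β) :
    (dEq s t).realize e = dEq (s.realize e) (t.realize e) := rfl

theorem realize_dNeg (s : LFS.Term β) : (dNeg s).realize e = dNeg (s.realize e) := rfl

theorem realize_dAnd (s t : LFS.Term β) :
    (dAnd s t).realize e = dAnd (s.realize e) (t.realize e) := rfl

theorem realize_dImp (s t : LFS.Term β) :
    (dImp s t).realize e = dImp (s.realize e) (t.realize e) := rfl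

theorem realize_dAll (s : LFS.Term β) : (dAll s).realize e = dAll (s.realize e) := rfl

theorem realize_dNat (s : LFS.Term β) : (dNat s).realize e = dNat (s.realize e) := rfl

theorem realize_lim (s : LFS.Term β) : (lim s).realize e = lim (s.realize e) := rfl

end Semantics

section Formulas

variable {n m : ℕ} (e : Empty → MKF)

theorem realize_v (xs : Fin n → MKF) (i : ℕ) (h : i < n) :
    (v i h : Tm n).realize (Sum.elim e xs) = xs ⟨i, h⟩ := rfl

theorem realize_fN (t : Tm n) (xs : Fin n → MKF) :
    (fN t).Realize e xs ↔ IsN (t.realize (Sum.elim e xs)) := Iff.rfl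

theorem realize_fT (t : Tm n) (xs : Fin n → MKF) :
    (fT t).Realize e xs ↔ IsT (t.realize (Sum.elim e xs)) := Iff.rfl

theorem realize_fU (t : Tm n) (xs : Fin n → MKF) :
    (fU t).Realize e xs ↔ IsU (t.realize (Sum.elim e xs)) := Iff.rfl

theorem snoc_last (xs : Fin n → MKF) (a : MKF) (h : n < n + 1) :
    (Fin.snoc xs a : Fin (n + 1) → MKF) ⟨n, h⟩ = a := Fin.snoc_last (α := fun _ => MKF) a xs

theorem snoc_lt (xs : Fin n → MKF) (a : MKF) {i : ℕ} (hi : i < n) (h : i < n + 1) :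
    (Fin.snoc xs a : Fin (n + 1) → MKF) ⟨i, h⟩ = xs ⟨i, hi⟩ :=
  Fin.snoc_castSucc (α := fun _ => MKF) a xs ⟨i, hi⟩

/-- The first `n` entries. -/
def params (h : n ≤ m) (xs : Fin m → MKF) : Fin n → MKF := fun i => xs ⟨i, lt_of_lt_of_le i.2 h⟩

theorem params_self (h : n ≤ n) (xs : Fin n → MKF) : params h xs = xs := rfl

theorem params_snoc (h : n ≤ m + 1) (h' : n ≤ m) (xs : Fin m → MKF) (a : MKF) :
    params h (Fin.snoc xs a) = params h' xs :=
  funext fun i => snoc_lt xs a (lt_of_lt_of_le i.2 h') _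

/-- The substitution lemma that turns the schemas into statements about arbitrary definable
predicates on the model. -/
theorem realize_inst (B : LFS.Formula (Fin (n + 1))) (t : Tm m) (h : n ≤ m) (xs : Fin m → MKF) :
    (inst B t h).Realize e xs ↔
      B.Realize (Fin.snoc (params h xs) (t.realize (Sum.elim e xs)) : Fin (n + 1) → MKF) := by
  unfold inst
  rw [BoundedFormula.realize_relabel, BoundedFormula.realize_subst, Formula.Realize]
  refine iff_of_eq (congrArg₂ _ (funext fun i => ?_) (Subsingleton.elim _ _))
  refine Fin.lastCases ?_ (fun i => ?_) i
  · rw [Fin.lastCases_last, Fin.snoc_last]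
    congr 1
  · rw [Fin.lastCases_castSucc, Fin.snoc_castSucc]
    rfl

theorem models_alls (φ : Fm n) : MKF ⊨ φ.alls ↔ ∀ xs : Fin n → MKF, φ.Realize default xs :=
  BoundedFormula.realize_alls

end Formulas

/-! ## The applicative axioms -/

theorem cls_eq_of_red {t u : ClosedTerm} (h : Red t u) : cls t = cls u :=
  Quotient.sound (.rel _ _ h)

theorem MKF.k_app (a b : MKF) : cst .k ⬝ a ⬝ b = a := by
  obtain ⟨a, rfl⟩ := cls_surjective a
  obtain ⟨b, rfl⟩ := cls_surjective b
  exact cls_eq_of_red (.k a b)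

theorem MKF.s_app (a b c : MKF) : cst .s ⬝ a ⬝ b ⬝ c = a ⬝ c ⬝ (b ⬝ c) := by
  obtain ⟨a, rfl⟩ := cls_surjective a
  obtain ⟨b, rfl⟩ := cls_surjective b
  obtain ⟨c, rfl⟩ := cls_surjective c
  exact cls_eq_of_red (.s a b c)

theorem MKF.p0_pair (a b : MKF) : cst .p0 ⬝ pair a b = a := by
  obtain ⟨a, rfl⟩ := cls_surjective a
  obtain ⟨b, rfl⟩ := cls_surjective b
  exact cls_eq_of_red (.p0 a b)

theorem MKF.p1_pair (a b : MKF) : cst .p1 ⬝ pair a b = b := by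
  obtain ⟨a, rfl⟩ := cls_surjective a
  obtain ⟨b, rfl⟩ := cls_surjective b
  exact cls_eq_of_red (.p1 a b)

theorem MKF.pN_num (n : ℕ) : (cst .pN ⬝ num (n + 1) : MKF) = num n := by
  rw [← cls_num, ← cls_num]
  exact cls_eq_of_red (.pN n)

theorem MKF.dN_num_eq (a b : MKF) (n : ℕ) : cst .dN ⬝ a ⬝ b ⬝ num n ⬝ num n = a := by
  obtain ⟨a, rfl⟩ := cls_surjective a
  obtain ⟨b, rfl⟩ := cls_surjective b
  rw [← cls_num]
  exact cls_eq_of_red (.dN_eq a b n)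

theorem MKF.dN_num_ne (a b : MKF) {m n : ℕ} (h : m ≠ n) :
    cst .dN ⬝ a ⬝ b ⬝ num m ⬝ num n = b := by
  obtain ⟨a, rfl⟩ := cls_surjective a
  obtain ⟨b, rfl⟩ := cls_surjective b
  rw [← cls_num, ← cls_num]
  exact cls_eq_of_red (.dN_ne a b m n h)

theorem isN_num (n : ℕ) : IsN (num n) := isN_iff.2 ⟨n, rfl⟩

set_option linter.unusedSimpArgs false

/-- The extension of `N` consists exactly of the numerals, so ordinary induction on ℕ applies. -/
theorem models_indAx {n : ℕ} (A : LFS.Formula (Fin (n + 1))) : MKF ⊨ indAx A := by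
  unfold indAx
  simp (disch := omega) only [models_alls, BoundedFormula.realize_imp,
    BoundedFormula.realize_inf, BoundedFormula.realize_sup, BoundedFormula.realize_not,
    BoundedFormula.realize_iff, BoundedFormula.realize_all, BoundedFormula.realize_ex,
    BoundedFormula.realize_bdEqual, realize_app, realize_cst, realize_pair, realize_dEq,
    realize_dNeg, realize_dAnd, realize_dImp, realize_dAll, realize_dNat, realize_lim, realize_v,
    realize_fN, realize_fT, realize_fU, realize_inst, params_self, params_snoc, snoc_last, snoc_lt,
    fP, fC]
  rintro xs ⟨h0, hS⟩ a ha
  obtain ⟨k, rfl⟩ := isN_iff.1 ha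
  induction k with
  | zero => exact h0
  | succ k ih => exact hS _ ⟨isN_num k, ih (isN_num k)⟩

theorem models_TON {φ : LFS.Sentence} (h : TON φ) : MKF ⊨ φ := by
  cases h
  case ind A => exact models_indAx A
  all_goals simp (disch := omega) only [models_alls, BoundedFormula.realize_imp,
    BoundedFormula.realize_inf, BoundedFormula.realize_sup, BoundedFormula.realize_not,
    BoundedFormula.realize_iff, BoundedFormula.realize_all, BoundedFormula.realize_ex,
    BoundedFormula.realize_bdEqual, realize_app, realize_cst, realize_pair, realize_dEq,
    realize_dNeg, realize_dAnd, realize_dImp, realize_dAll, realize_dNat, realize_lim, realize_v,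
    realize_fN, realize_fT, realize_fU, realize_inst, params_self, params_snoc, snoc_last, snoc_lt,
    fP, fC]
  case k => exact fun _ => MKF.k_app _ _
  case s => exact fun _ => MKF.s_app _ _ _
  case pair => exact fun _ => ⟨MKF.p0_pair _ _, MKF.p1_pair _ _⟩
  case nat =>
    refine fun _ => ⟨isN_num 0, fun a ha => ?_⟩
    obtain ⟨k, rfl⟩ := isN_iff.1 ha
    exact isN_num (k + 1)
  case succ =>
    intro _ a ha
    obtain ⟨k, rfl⟩ := isN_iff.1 ha
    exact ⟨MKF.app_ne_cst (by simp [InertOne]) _, MKF.pN_num k⟩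
  case pred =>
    rintro _ a ⟨ha, h0⟩
    obtain ⟨_ | k, rfl⟩ := isN_iff.1 ha
    · exact (h0 rfl).elim
    · rw [MKF.pN_num]
      exact ⟨isN_num k, rfl⟩
  case dN_eq =>
    rintro xs ⟨⟨ha, hb⟩, e⟩
    rw [← e]
    obtain ⟨k, hk⟩ := isN_iff.1 ha
    rw [hk]
    exact MKF.dN_num_eq _ _ k
  case dN_ne =>
    rintro xs ⟨⟨ha, hb⟩, e⟩
    obtain ⟨k, hk⟩ := isN_iff.1 ha
    obtain ⟨l, hl⟩ := isN_iff.1 hb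
    rw [hk, hl] at e ⊢
    exact MKF.dN_num_ne _ _ fun h => e (h ▸ rfl)

/-! ## The truth axioms and the universe axioms -/

theorem models_KFTruth {φ : LFS.Sentence} (h : KFTruth φ) : MKF ⊨ φ := by
  cases h <;>
  simp (disch := omega) only [models_alls, BoundedFormula.realize_imp,
    BoundedFormula.realize_inf, BoundedFormula.realize_sup, BoundedFormula.realize_not,
    BoundedFormula.realize_iff, BoundedFormula.realize_all, BoundedFormula.realize_ex,
    BoundedFormula.realize_bdEqual, realize_app, realize_cst, realize_pair, realize_dEq,
    realize_dNeg, realize_dAnd, realize_dImp, realize_dAll, realize_dNat, realize_lim, realize_v,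
    realize_fN, realize_fT, realize_fU, realize_inst, params_self, params_snoc, snoc_last, snoc_lt,
    fP, fC]
  case eq => exact fun _ => dEq_mem
  case ne => exact fun _ => not_dEq_mem
  case nat => exact fun _ => dNat_mem
  case not_nat => exact fun _ => not_dNat_mem
  case not_not => exact fun _ => not_not_mem
  case and => exact fun _ => dAnd_mem
  case not_and => exact fun _ => not_dAnd_mem
  case imp => exact fun _ => dImp_mem
  case not_imp => exact fun _ => not_dImp_mem
  case all => exact fun _ => dAll_mem
  case not_all => exact fun _ => not_dAll_mem
  case cons => exact fun _ h => Z_consistent h.1 h.2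

theorem models_KFUniv {φ : LFS.Sentence} (h : KFUniv φ) : MKF ⊨ φ := by
  cases h <;>
  simp (disch := omega) only [models_alls, BoundedFormula.realize_imp,
    BoundedFormula.realize_inf, BoundedFormula.realize_sup, BoundedFormula.realize_not,
    BoundedFormula.realize_iff, BoundedFormula.realize_all, BoundedFormula.realize_ex,
    BoundedFormula.realize_bdEqual, realize_app, realize_cst, realize_pair, realize_dEq,
    realize_dNeg, realize_dAnd, realize_dImp, realize_dAll, realize_dNat, realize_lim, realize_v,
    realize_fN, realize_fT, realize_fU, realize_inst, params_self, params_snoc, snoc_last, snoc_lt,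
    fP, fC]
  case lim => exact fun xs hf =>
    ⟨⟨_, rfl, hf⟩, fun x => (lim_reflects hf x).1, fun x => (lim_reflects hf x).2⟩
  all_goals
    intro xs hu
    obtain ⟨β, hβ, h⟩ := hu.exists_stage
    -- Truth of `u ⬝ c` becomes membership of c in `Z β`, so the relativised truth axioms become the
    -- truth clauses at stage β.
    simp only [fun c => (h c).1]
  case eq => exact fun _ _ => dEq_mem
  case ne => exact fun _ _ => not_dEq_mem
  case nat => exact fun _ => dNat_mem
  case not_nat => exact fun _ => not_dNat_mem
  case not_not => exact fun _ => not_not_mem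
  case and => exact fun _ _ => dAnd_mem
  case not_and => exact fun _ _ => not_dAnd_mem
  case imp => exact fun _ _ => dImp_mem
  case not_imp => exact fun _ _ => not_dImp_mem
  case all => exact fun _ => dAll_mem
  case not_all => exact fun _ => not_dAll_mem
  case cons => exact fun _ h => Z_consistent h.1 h.2
  case cls => exact fun c => (em (c ∈ Z β)).imp id (h c).2.2
  case true => exact fun _ hx => Z_mono hβ hx

/-! ## Unique generation and proposition induction -/

theorem models_UG {φ : LFS.Sentence} (h : UG φ) : MKF ⊨ φ := by
  cases h <;>
  simp (disch := omega) only [models_alls, BoundedFormula.realize_imp,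
    BoundedFormula.realize_inf, BoundedFormula.realize_sup, BoundedFormula.realize_not,
    BoundedFormula.realize_iff, BoundedFormula.realize_all, BoundedFormula.realize_ex,
    BoundedFormula.realize_bdEqual, realize_app, realize_cst, realize_pair, realize_dEq,
    realize_dNeg, realize_dAnd, realize_dImp, realize_dAll, realize_dNat, realize_lim, realize_v,
    realize_fN, realize_fT, realize_fU, realize_inst, params_self, params_snoc, snoc_last, snoc_lt,
    fP, fC]
  case const_ne hc hd hcd => exact fun _ h => hcd (MKF.cst_inj h)
  case app_ne_const hc hd => exact fun _ => MKF.app_ne_cst hc.inertOne _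
  case app_ne hc hd hcd => exact fun _ => MKF.generator_app_ne hc hd hcd _ _
  case app_inj hc => exact fun _ => (MKF.generator_app_inj hc).1
  case lim_ne_const => exact fun _ => MKF.app₂_ne_cst inertTwo_l _ _
  case lim_ne_app hc => exact fun _ => MKF.app₂_ne_app inertTwo_l hc.inertOne _ _ _
  case lim_inj => exact fun _ => MKF.app₂_inj inertTwo_l

theorem models_propInd {n : ℕ} (B : LFS.Formula (Fin (n + 1))) : MKF ⊨ propInd B := by
  unfold propInd opA
  simp (disch := omega) only [models_alls, BoundedFormula.realize_imp,
    BoundedFormula.realize_inf, BoundedFormula.realize_sup, BoundedFormula.realize_not,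
    BoundedFormula.realize_iff, BoundedFormula.realize_all, BoundedFormula.realize_ex,
    BoundedFormula.realize_bdEqual, realize_app, realize_cst, realize_pair, realize_dEq,
    realize_dNeg, realize_dAnd, realize_dImp, realize_dAll, realize_dNat, realize_lim, realize_v,
    realize_fN, realize_fT, realize_fU, realize_inst, params_self, params_snoc, snoc_last, snoc_lt,
    fP, fC]
  intro xs hB x hx
  refine prop_induction (B := fun x => B.Realize (Fin.snoc xs x : Fin (n + 1) → MKF))
    (fun x h => hB x ?_) hx
  -- Disjunctions in `opA` associate to the left, those in `OpA` to the right.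
  simpa only [OpA, or_assoc] using h

end FregeStructure

theorem mainTheorem8 :
    FregeStructure.MKF ⊨ FregeStructure.KFUPI ∧ FregeStructure.MKF ⊨ FregeStructure.KF := by
  constructor <;> refine Theory.model_iff _ |>.2 fun φ h => ?_
  · rcases h with ((h | h) | h) | ⟨n, B, rfl⟩
    · exact FregeStructure.models_TON h
    · exact FregeStructure.models_KFUniv h
    · exact FregeStructure.models_UG h
    · exact FregeStructure.models_propInd B
  · exact h.elim FregeStructure.models_TON FregeStructure.models_KFTruth
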